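/- Let $\Sigma$ be an alphabet and let $S$ be a semigroup generated by $\Sigma$ (via a map $\Sigma\to S$ whose image generates $S$), where $\Sigma$ is finite or $S$ is finite. For $s,t\in S$ let $S^1=S\cup\{1\}$ (with a new neutral element $1$), let $s\mathrel{\mathcal L}t$ iff $xs=t$ and $s=x't$ for some $x,x'\in S^1$, $s\mathrel{\mathcal R}t$ iff $sy=t$ and $s=ty'$ for some $y,y'\in S^1$, and let $\mathcal D$ be the equivalence relation generated by $\mathcal L\cup\mathcal R$. A $\mathcal D$-class is regular if it contains an idempotent. Let $\mathbf{DAb}_S$ be the class of all finite semigroups each of whose regular $\mathcal D$-classes forms an Abelian group under the multiplication of the semigroup. The positions of a word $w=a_1\cdots a_k\in\Sigma^*$ are $-\infty<1<\dots<k<+\infty$. For a position $p$ and $a\in\Sigma$ let $X_a(w;p)$ be the smallest position $q\in\{1,\dots,k\}$ with $q>p$ and $a_q=a$ ($+\infty$ if there is none), $Y_a(w;p)$ the largest position $q\in\{1,\dots,k\}$ with $q<p$ and $a_q=a$ ($-\infty$ if there is none), $X_{+\infty}(w;p)=+\infty$ and $Y_{-\infty}(w;p)=-\infty$. An $X$-ranker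 $\rho$ is a finite word over $\{X_a\mid a\in\Sigma\}\cup\{X_{+\infty}\}$, a $Y$-ranker $\lambda$ is a finite word over $\{Y_a\mid a\in\Sigma\}\cup\{Y_{-\infty}\}$; $\rho(w)$ is the position obtained by executing the instructions of $\rho$ from left to right starting at $-\infty$, and $\lambda(w)$ is the position obtained by executing those of $\lambda$ from left to right starting at $+\infty$. If $\rho(w)\le\lambda(w)$, the $\rho$-$\lambda$-split of $w$ is $(w_0,w_1,w_2)$, where $w_0$, $w_1$, $w_2$ consist of the letters at the positions in $\{1,\dots,k\}$ that are $<\rho(w)$, strictly between $\rho(w)$ and $\lambda(w)$, and $>\lambda(w)$, respectively. Write $\operatorname{alph}(w)$ for the set of letters of $w$ and $|w|_a$ for the number of occurrences of $a$ in $w$. For $m\ge1$ let $u\sim_{m,\rho,\lambda}v$ if for all prefixes $\rho'$ of $\rho X_{+\infty}$ and $\lambda'$ of $\lambda Y_{-\infty}$: (1) $\rho'(u)$ compares to $\lambda'(u)$ ($<$, $=$ or $>$) in the same way as $\rho'(v)$ compares to $\lambda'(v)$; and (2) if $\rho'(u)\le\lambda'(u)$ and $\rho'(v)\le\lambda'(v)$,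 then for the $\rho'$-$\lambda'$-splits $(u_0,u_1,u_2)$ of $u$ and $(v_0,v_1,v_2)$ of $v$ we have $\operatorname{alph}(u_1)=\operatorname{alph}(v_1)$ and, for all $a\in\Sigma\setminus\operatorname{alph}(u_1)$, $|u_0|_a\equiv|v_0|_a$ and $|u_2|_a\equiv|v_2|_a \pmod m$. Let $u\approx_{m,n}v$ if $u\sim_{m,\rho,\lambda}v$ for all $X$-rankers $\rho$ and $Y$-rankers $\lambda$ with $|\rho|+|\lambda|\le n$. This is a congruence on the free semigroup $\Sigma^+$. Then $S$ is in $\mathbf{DAb}_S$ if and only if there are integers $m,n\ge1$ and a surjective semigroup homomorphism $\Sigma^+/{\approx_{m,n}}\to S$. -/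

import Mathlib

namespace DAb

/-! ### Positions, rankers and their evaluation -/

/-- Positions of a word: `⊥` is the imaginary position `-∞` before the first letter, `⊤` is the
imaginary position `+∞` after the last letter, and the natural number `i` is the position of the
letter with (zero-based) index `i`. -/
abbrev Pos : Type := WithBot (WithTop ℕ)

/-- The actual position with index `i`. -/
def at' (i : ℕ) : Pos := ((i : WithTop ℕ) : WithBot (WithTop ℕ))

/-- The instructions of an `X`-ranker: `next a` is `X_a` (go to the next `a` on the right) and
`toEnd` is `X_{+∞}`. -/
inductive XInstr (A : Type*) where
  | next (a : A) : XInstr A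
  | toEnd : XInstr A

/-- The instructions of a `Y`-ranker: `prev a` is `Y_a` (go to the next `a` on the left) and
`toStart` is `Y_{-∞}`. -/
inductive YInstr (A : Type*) where
  | prev (a : A) : YInstr A
  | toStart : YInstr A

/-- `X_a(w; p)` is the infimum of all positions `q > p` of `w` with label `a`
(the infimum of the empty set is `+∞`), and `X_{+∞}(w; p) = +∞`. -/
noncomputable def XInstr.eval {A : Type*} (w : List A) (p : Pos) : XInstr A → Pos
  | .next a => sInf {q | p < q ∧ ∃ i : ℕ, q = at' i ∧ w[i]? = some a}
  | .toEnd => ⊤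

/-- `Y_a(w; p)` is the supremum of all positions `q < p` of `w` with label `a`
(the supremum of the empty set is `-∞`), and `Y_{-∞}(w; p) = -∞`. -/
noncomputable def YInstr.eval {A : Type*} (w : List A) (p : Pos) : YInstr A → Pos
  | .prev a => sSup {q | q < p ∧ ∃ i : ℕ, q = at' i ∧ w[i]? = some a}
  | .toStart => ⊥

/-- An `X`-ranker is a finite word of `X`-instructions. -/
abbrev XRanker (A : Type*) : Type _ := List (XInstr A)

/-- A `Y`-ranker is a finite word of `Y`-instructions. -/
abbrev YRanker (A : Type*) : Type _ := List (YInstr A)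

/-- `ρ(w)`: the instructions are executed from left to right, starting at `-∞`. -/
noncomputable def xEval {A : Type*} (ρ : XRanker A) (w : List A) : Pos :=
  ρ.foldl (fun p X => X.eval w p) ⊥

/-- `λ(w)`: the instructions are executed from left to right, starting at `+∞`. -/
noncomputable def yEval {A : Type*} (l : YRanker A) (w : List A) : Pos :=
  l.foldl (fun p Y => Y.eval w p) ⊤

/-! ### Splits and the relations -/

open Classical in
/-- The factor of `w` containing the positions strictly between `p` and `q`. -/
noncomputable def between {A : Type*} (w : List A) (p q : Pos) : List A :=
  (w.zipIdx.filter (fun x => p < at' x.2 ∧ at' x.2 < q)).map Prod.fst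

/-- The left part of the `ρ`-`λ`-split: all positions smaller than `ρ(w)`. -/
noncomputable def leftPart {A : Type*} (ρ : XRanker A) (w : List A) : List A :=
  between w ⊥ (xEval ρ w)

/-- The middle part of the `ρ`-`λ`-split: all positions greater than `ρ(w)` and smaller
than `λ(w)`. -/
noncomputable def middlePart {A : Type*} (ρ : XRanker A) (l : YRanker A) (w : List A) : List A :=
  between w (xEval ρ w) (yEval l w)

/-- The right part of the `ρ`-`λ`-split: all positions greater than `λ(w)`. -/
noncomputable def rightPart {A : Type*} (l : YRanker A) (w : List A) : List A :=
  between w (yEval l w) ⊤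

/-- The set of letters that occur in a word. -/
def alph {A : Type*} (w : List A) : Set A := {a | a ∈ w}

open Classical in
/-- The number of occurrences of the letter `a` in `w`. -/
noncomputable def cnt {A : Type*} (a : A) (w : List A) : ℕ := w.count a

/-- `ord[ρ, λ; w]`: whether `ρ(w) < λ(w)`, `ρ(w) = λ(w)` or `ρ(w) > λ(w)`. -/
noncomputable def ord {A : Type*} (ρ : XRanker A) (l : YRanker A) (w : List A) : Ordering :=
  cmp (xEval ρ w) (yEval l w)

/-- `u` and `v` are `ρ`-`λ`-compatible. -/
def Compatible {A : Type*} (ρ : XRanker A) (l : YRanker A) (u v : List A) : Prop :=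
  ∀ (ρ' : XRanker A) (l' : YRanker A), ρ' <+: ρ ++ [XInstr.toEnd] → l' <+: l ++ [YInstr.toStart] →
    ord ρ' l' u = ord ρ' l' v

/-- The relation `u ∼_{m,ρ,λ} v`. -/
def Sim {A : Type*} (m : ℕ) (ρ : XRanker A) (l : YRanker A) (u v : List A) : Prop :=
  Compatible ρ l u v ∧
  ∀ (ρ' : XRanker A) (l' : YRanker A), ρ' <+: ρ ++ [XInstr.toEnd] → l' <+: l ++ [YInstr.toStart] →
    xEval ρ' u ≤ yEval l' u → xEval ρ' v ≤ yEval l' v →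
      alph (middlePart ρ' l' u) = alph (middlePart ρ' l' v) ∧
      ∀ a, a ∉ alph (middlePart ρ' l' u) →
        cnt a (leftPart ρ' u) ≡ cnt a (leftPart ρ' v) [MOD m] ∧
        cnt a (rightPart l' u) ≡ cnt a (rightPart l' v) [MOD m]

/-- The relation `u ≈_{m,n} v`. -/
def Approx {A : Type*} (m n : ℕ) (u v : List A) : Prop :=
  ∀ (ρ : XRanker A) (l : YRanker A), ρ.length + l.length ≤ n → Sim m ρ l u v

/-! ### `≈_{m,n}` is a congruence -/

theorem Approx.refl {A : Type*} (m n : ℕ) (u : List A) : Approx m n u u :=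
  fun _ _ _ => ⟨fun _ _ _ _ => rfl, fun _ _ _ _ _ _ => ⟨rfl, fun _ _ => ⟨rfl, rfl⟩⟩⟩

theorem Approx.symm {A : Type*} {m n : ℕ} {u v : List A} (h : Approx m n u v) : Approx m n v u := by
  intro ρ l hn
  obtain ⟨h1, h2⟩ := h ρ l hn
  refine ⟨fun ρ' l' a b => (h1 ρ' l' a b).symm, fun ρ' l' a b c d => ?_⟩
  obtain ⟨h3, h4⟩ := h2 ρ' l' a b d c
  refine ⟨h3.symm, fun x hx => ?_⟩
  rw [← h3] at hx
  exact ⟨(h4 x hx).1.symm, (h4 x hx).2.symm⟩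

theorem le_iff_of_ord {A : Type*} {ρ : XRanker A} {l : YRanker A} {u v : List A}
    (h : ord ρ l u = ord ρ l v) : xEval ρ u ≤ yEval l u ↔ xEval ρ v ≤ yEval l v :=
  le_iff_le_of_cmp_eq_cmp h

theorem Approx.trans {A : Type*} {m n : ℕ} {u v w : List A} (h : Approx m n u v)
    (k : Approx m n v w) : Approx m n u w := by
  intro ρ l hn
  obtain ⟨h1, h2⟩ := h ρ l hn
  obtain ⟨k1, k2⟩ := k ρ l hn
  refine ⟨fun ρ' l' a b => (h1 ρ' l' a b).trans (k1 ρ' l' a b), fun ρ' l' a b c d => ?_⟩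
  have e := (le_iff_of_ord (h1 ρ' l' a b)).1 c
  obtain ⟨h3, h4⟩ := h2 ρ' l' a b c e
  obtain ⟨k3, k4⟩ := k2 ρ' l' a b e d
  refine ⟨h3.trans k3, fun x hx => ?_⟩
  have hx' := hx
  rw [h3] at hx'
  exact ⟨(h4 x hx).1.trans (k4 x hx').1, (h4 x hx).2.trans (k4 x hx').2⟩

/-- Moving a position by `k` places to the right. -/
def shift (k : ℕ) : Pos → Pos
  | none => ⊥
  | some none => ⊤
  | some (some i) => at' (k + i)

theorem pos_cases (p : Pos) : p = ⊥ ∨ p = ⊤ ∨ ∃ i, p = at' i := by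
  rcases p with _ | _ | i
  · exact Or.inl rfl
  · exact Or.inr (Or.inl rfl)
  · exact Or.inr (Or.inr ⟨i, rfl⟩)

@[simp] theorem at_lt_at {i j : ℕ} : at' i < at' j ↔ i < j := by simp [at']
@[simp] theorem at_le_at {i j : ℕ} : at' i ≤ at' j ↔ i ≤ j := by simp [at']
@[simp] theorem at_inj {i j : ℕ} : at' i = at' j ↔ i = j := by simp [at']
@[simp] theorem bot_lt_at {i : ℕ} : ⊥ < at' i := by simp [at']
@[simp] theorem at_lt_top {i : ℕ} : at' i < ⊤ := by
  rw [lt_top_iff_ne_top]; intro h; cases h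
@[simp] theorem at_ne_top {i : ℕ} : at' i ≠ ⊤ := at_lt_top.ne
@[simp] theorem at_ne_bot {i : ℕ} : at' i ≠ ⊥ := bot_lt_at.ne'
@[simp] theorem top_ne_bot' : (⊤ : Pos) ≠ ⊥ := top_ne_bot
@[simp] theorem shift_bot {k : ℕ} : shift k ⊥ = ⊥ := rfl
@[simp] theorem shift_top {k : ℕ} : shift k ⊤ = ⊤ := rfl
@[simp] theorem shift_at {k i : ℕ} : shift k (at' i) = at' (k + i) := rfl

theorem cmp_shift {k : ℕ} (p q : Pos) : cmp (shift k p) (shift k q) = cmp p q := by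
  have mono : ∀ p q : Pos, p < q → shift k p < shift k q := by
    intro p q h
    rcases pos_cases p with rfl | rfl | ⟨i, rfl⟩ <;> rcases pos_cases q with rfl | rfl | ⟨j, rfl⟩ <;>
      simp_all
  rcases lt_trichotomy p q with h | rfl | h
  · rw [(cmp_eq_lt_iff _ _).2 h, (cmp_eq_lt_iff _ _).2 (mono _ _ h)]
  · simp
  · rw [(cmp_eq_gt_iff _ _).2 h, (cmp_eq_gt_iff _ _).2 (mono _ _ h)]

theorem next_top {A : Type*} {w : List A} {p : Pos} {a : A}
    (h : ∀ i, p < at' i → w[i]? ≠ some a) : (XInstr.next a).eval w p = ⊤ := by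
  simp only [XInstr.eval]
  rw [sInf_eq_top]
  rintro _ ⟨h1, i, rfl, h2⟩
  exact (h i h1 h2).elim

theorem next_at {A : Type*} {w : List A} {p : Pos} {a : A} {i : ℕ} (hp : p < at' i)
    (hi : w[i]? = some a) (h : ∀ j, p < at' j → w[j]? = some a → i ≤ j) :
    (XInstr.next a).eval w p = at' i := by
  simp only [XInstr.eval]
  apply le_antisymm
  · exact sInf_le ⟨hp, i, rfl, hi⟩
  · apply le_sInf
    rintro _ ⟨h1, j, rfl, h2⟩
    exact at_le_at.2 (h j h1 h2)

theorem next_cases {A : Type*} (w : List A) (p : Pos) (a : A) :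
    ((∀ i, p < at' i → w[i]? ≠ some a) ∧ (XInstr.next a).eval w p = ⊤) ∨
    ∃ i, p < at' i ∧ w[i]? = some a ∧ (∀ j, p < at' j → w[j]? = some a → i ≤ j) ∧
      (XInstr.next a).eval w p = at' i := by
  classical
  by_cases h : ∃ i, p < at' i ∧ w[i]? = some a
  · refine Or.inr ⟨Nat.find h, (Nat.find_spec h).1, (Nat.find_spec h).2, ?_, ?_⟩
    · exact fun j h1 h2 => Nat.find_min' h ⟨h1, h2⟩
    · exact next_at (Nat.find_spec h).1 (Nat.find_spec h).2
        fun j h1 h2 => Nat.find_min' h ⟨h1, h2⟩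
  · push Not at h
    exact Or.inl ⟨h, next_top h⟩

theorem prev_bot {A : Type*} {w : List A} {p : Pos} {a : A}
    (h : ∀ i, at' i < p → w[i]? ≠ some a) : (YInstr.prev a).eval w p = ⊥ := by
  simp only [YInstr.eval]
  rw [sSup_eq_bot]
  rintro _ ⟨h1, i, rfl, h2⟩
  exact (h i h1 h2).elim

theorem prev_at {A : Type*} {w : List A} {p : Pos} {a : A} {i : ℕ} (hp : at' i < p)
    (hi : w[i]? = some a) (h : ∀ j, at' j < p → w[j]? = some a → j ≤ i) :
    (YInstr.prev a).eval w p = at' i := by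
  simp only [YInstr.eval]
  apply le_antisymm
  · apply sSup_le
    rintro _ ⟨h1, j, rfl, h2⟩
    exact at_le_at.2 (h j h1 h2)
  · exact le_sSup ⟨hp, i, rfl, hi⟩

theorem prev_cases {A : Type*} (w : List A) (p : Pos) (a : A) :
    ((∀ i, at' i < p → w[i]? ≠ some a) ∧ (YInstr.prev a).eval w p = ⊥) ∨
    ∃ i, at' i < p ∧ w[i]? = some a ∧ (∀ j, at' j < p → w[j]? = some a → j ≤ i) ∧
      (YInstr.prev a).eval w p = at' i := by
  classical
  by_cases h : ∃ i, at' i < p ∧ w[i]? = some a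
  · have hb : ∀ i, (at' i < p ∧ w[i]? = some a) → i ≤ w.length := by
      rintro i ⟨_, h2⟩
      obtain ⟨h3, _⟩ := List.getElem?_eq_some_iff.1 h2
      exact h3.le
    obtain ⟨i0, hi0⟩ := h
    have hs := Nat.findGreatest_spec (P := fun i => at' i < p ∧ w[i]? = some a) (hb _ hi0) hi0
    have hm : ∀ j, at' j < p → w[j]? = some a →
        j ≤ Nat.findGreatest (fun i => at' i < p ∧ w[i]? = some a) w.length :=
      fun j h1 h2 => Nat.le_findGreatest (hb j ⟨h1, h2⟩) ⟨h1, h2⟩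
    exact Or.inr ⟨_, hs.1, hs.2, hm, prev_at hs.1 hs.2 hm⟩
  · push Not at h
    exact Or.inl ⟨h, prev_bot h⟩

@[simp] theorem xEval_nil {A : Type*} (w : List A) : xEval [] w = ⊥ := rfl
@[simp] theorem yEval_nil {A : Type*} (w : List A) : yEval [] w = ⊤ := rfl
theorem xEval_snoc {A : Type*} (ρ : XRanker A) (X : XInstr A) (w : List A) :
    xEval (ρ ++ [X]) w = X.eval w (xEval ρ w) := by simp [xEval]
theorem yEval_snoc {A : Type*} (l : YRanker A) (Y : YInstr A) (w : List A) :
    yEval (l ++ [Y]) w = Y.eval w (yEval l w) := by simp [yEval]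

theorem next_bound {A : Type*} (X : XInstr A) (w : List A) (p : Pos) :
    X.eval w p = ⊤ ∨ ∃ i, X.eval w p = at' i ∧ i < w.length := by
  cases X with
  | toEnd => exact Or.inl rfl
  | next a =>
    rcases next_cases w p a with h | ⟨i, _, h, _, h'⟩
    · exact Or.inl h.2
    · exact Or.inr ⟨i, h', (List.getElem?_eq_some_iff.1 h).1⟩

theorem prev_bound {A : Type*} (Y : YInstr A) (w : List A) (p : Pos) :
    Y.eval w p = ⊥ ∨ ∃ i, Y.eval w p = at' i ∧ i < w.length := by
  cases Y with
  | toStart => exact Or.inl rfl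
  | prev a =>
    rcases prev_cases w p a with h | ⟨i, _, h, _, h'⟩
    · exact Or.inl h.2
    · exact Or.inr ⟨i, h', (List.getElem?_eq_some_iff.1 h).1⟩

theorem xEval_ne_bot {A : Type*} {ρ : XRanker A} (h : ρ ≠ []) (w : List A) : xEval ρ w ≠ ⊥ := by
  obtain ⟨ρ, X, rfl⟩ := List.eq_nil_or_concat ρ |>.resolve_left h
  rw [List.concat_eq_append, xEval_snoc]
  rcases next_bound X w (xEval ρ w) with h | ⟨i, h, _⟩ <;> simp [h]

theorem yEval_ne_top {A : Type*} {l : YRanker A} (h : l ≠ []) (w : List A) : yEval l w ≠ ⊤ := by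
  obtain ⟨l, Y, rfl⟩ := List.eq_nil_or_concat l |>.resolve_left h
  rw [List.concat_eq_append, yEval_snoc]
  rcases prev_bound Y w (yEval l w) with h | ⟨i, h, _⟩ <;> simp [h]

theorem xEval_lt {A : Type*} (ρ : XRanker A) (w : List A) (h : xEval ρ w ≠ ⊤) :
    xEval ρ w < at' w.length := by
  rcases List.eq_nil_or_concat ρ with rfl | ⟨ρ, X, rfl⟩
  · simp
  · rw [List.concat_eq_append, xEval_snoc] at *
    rcases next_bound X w (xEval ρ w) with h' | ⟨i, h', hi⟩
    · exact (h h').elim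
    · simpa [h'] using hi

theorem yEval_lt {A : Type*} (l : YRanker A) (w : List A) (h : yEval l w ≠ ⊤) :
    yEval l w < at' w.length := by
  rcases List.eq_nil_or_concat l with rfl | ⟨l, Y, rfl⟩
  · simp at h
  · rw [List.concat_eq_append, yEval_snoc] at *
    rcases prev_bound Y w (yEval l w) with h' | ⟨i, h', hi⟩
    · simp [h']
    · simpa [h'] using hi

/-- An `X`-instruction that stays inside the left factor. -/
theorem next_left {A : Type*} (X : XInstr A) (u v : List A) (p : Pos) (h : X.eval u p ≠ ⊤) :
    X.eval (u ++ v) p = X.eval u p := by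
  cases X with
  | toEnd => exact (h rfl).elim
  | next a =>
    rcases next_cases u p a with ⟨_, h'⟩ | ⟨i, h1, h2, h3, h4⟩
    · exact (h h').elim
    · have hi := (List.getElem?_eq_some_iff.1 h2).1
      rw [h4]
      refine next_at h1 ?_ ?_
      · rw [List.getElem?_append_left hi, h2]
      · intro j hj1 hj2
        by_contra hlt
        rw [List.getElem?_append_left (by omega)] at hj2
        exact hlt (h3 j hj1 hj2)

/-- An `X`-instruction that leaves the left factor. -/
theorem next_cross {A : Type*} (X : XInstr A) (u v : List A) (p : Pos) (hp : p < at' u.length)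
    (h : X.eval u p = ⊤) : X.eval (u ++ v) p = shift u.length (X.eval v ⊥) := by
  cases X with
  | toEnd => rfl
  | next a =>
    have hu : ∀ i, p < at' i → u[i]? ≠ some a := by
      rcases next_cases u p a with ⟨h', _⟩ | ⟨i, _, _, _, h4⟩
      · exact h'
      · rw [h4] at h; exact (at_ne_top h).elim
    have hge : ∀ j, p < at' j → (u ++ v)[j]? = some a → u.length ≤ j := by
      intro j hj1 hj2
      by_contra hlt
      rw [List.getElem?_append_left (by omega)] at hj2
      exact hu j hj1 hj2
    rcases next_cases v ⊥ a with ⟨h1, h2⟩ | ⟨i, _, h2, h3, h4⟩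
    · rw [h2, shift_top]
      refine next_top fun j hj1 hj2 => ?_
      have := hge j hj1 hj2
      rw [List.getElem?_append_right this] at hj2
      exact h1 _ bot_lt_at hj2
    · rw [h4, shift_at]
      refine next_at (hp.trans_le (by simp)) ?_ ?_
      · rw [List.getElem?_append_right (by omega), Nat.add_sub_cancel_left, h2]
      · intro j hj1 hj2
        have := hge j hj1 hj2
        rw [List.getElem?_append_right this] at hj2
        have := h3 _ bot_lt_at hj2
        omega

/-- An `X`-instruction inside the right factor. -/
theorem next_right {A : Type*} (X : XInstr A) (u v : List A) (p : Pos) (hp : p ≠ ⊥) :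
    X.eval (u ++ v) (shift u.length p) = shift u.length (X.eval v p) := by
  cases X with
  | toEnd => rfl
  | next a =>
    rcases pos_cases p with rfl | rfl | ⟨k, rfl⟩
    · exact (hp rfl).elim
    · rw [shift_top, next_top (by simp), next_top (by simp), shift_top]
    · rw [shift_at]
      rcases next_cases v (at' k) a with ⟨h1, h2⟩ | ⟨i, h1, h2, h3, h4⟩
      · rw [h2, shift_top]
        refine next_top fun j hj1 hj2 => ?_
        rw [at_lt_at] at hj1
        rw [List.getElem?_append_right (by omega)] at hj2
        exact h1 _ (at_lt_at.2 (by omega)) hj2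
      · rw [h4, shift_at]
        rw [at_lt_at] at h1
        refine next_at (at_lt_at.2 (by omega)) ?_ ?_
        · rw [List.getElem?_append_right (by omega), Nat.add_sub_cancel_left, h2]
        · intro j hj1 hj2
          rw [at_lt_at] at hj1
          rw [List.getElem?_append_right (by omega)] at hj2
          have := h3 _ (at_lt_at.2 (by omega)) hj2
          omega

/-- A `Y`-instruction that stays inside the right factor. -/
theorem prev_right {A : Type*} (Y : YInstr A) (u v : List A) (p : Pos) (h : Y.eval v p ≠ ⊥) :
    Y.eval (u ++ v) (shift u.length p) = shift u.length (Y.eval v p) := by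
  cases Y with
  | toStart => exact (h rfl).elim
  | prev a =>
    have key : ∀ i, at' (u.length + i) < shift u.length p ↔ at' i < p := by
      intro i
      rcases pos_cases p with rfl | rfl | ⟨k, rfl⟩ <;> simp
    rcases prev_cases v p a with ⟨_, h'⟩ | ⟨i, h1, h2, h3, h4⟩
    · exact (h h').elim
    · rw [h4, shift_at]
      refine prev_at ((key i).2 h1) ?_ ?_
      · rw [List.getElem?_append_right (by omega), Nat.add_sub_cancel_left, h2]
      · intro j hj1 hj2
        by_contra hlt
        rw [List.getElem?_append_right (by omega)] at hj2
        obtain ⟨j, rfl⟩ := Nat.exists_eq_add_of_le (show u.length ≤ j by omega)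
        rw [Nat.add_sub_cancel_left] at hj2
        have := h3 j ((key j).1 hj1) hj2
        omega

/-- A `Y`-instruction that leaves the right factor. -/
theorem prev_cross {A : Type*} (Y : YInstr A) (u v : List A) (p : Pos) (hp : p ≠ ⊥)
    (h : Y.eval v p = ⊥) : Y.eval (u ++ v) (shift u.length p) = Y.eval u ⊤ := by
  cases Y with
  | toStart => rfl
  | prev a =>
    have key : ∀ i, at' (u.length + i) < shift u.length p ↔ at' i < p := by
      intro i
      rcases pos_cases p with rfl | rfl | ⟨k, rfl⟩ <;> simp
    have hpu : ∀ i, i < u.length → at' i < shift u.length p := by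
      intro i hi
      rcases pos_cases p with rfl | rfl | ⟨k, rfl⟩
      · exact (hp rfl).elim
      · simp
      · simp; omega
    have hv : ∀ i, at' i < p → v[i]? ≠ some a := by
      rcases prev_cases v p a with ⟨h', _⟩ | ⟨i, _, _, _, h4⟩
      · exact h'
      · rw [h4] at h; exact (at_ne_bot h).elim
    have hlt : ∀ j, at' j < shift u.length p → (u ++ v)[j]? = some a → j < u.length := by
      intro j hj1 hj2
      by_contra hge
      rw [List.getElem?_append_right (by omega)] at hj2
      obtain ⟨j, rfl⟩ := Nat.exists_eq_add_of_le (show u.length ≤ j by omega)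
      rw [Nat.add_sub_cancel_left] at hj2
      exact hv j ((key j).1 hj1) hj2
    rcases prev_cases u ⊤ a with ⟨h1, h2⟩ | ⟨i, h1, h2, h3, h4⟩
    · rw [h2]
      refine prev_bot fun j hj1 hj2 => ?_
      have := hlt j hj1 hj2
      rw [List.getElem?_append_left this] at hj2
      exact h1 _ at_lt_top hj2
    · have hi := (List.getElem?_eq_some_iff.1 h2).1
      rw [h4]
      refine prev_at (hpu i hi) ?_ ?_
      · rw [List.getElem?_append_left hi, h2]
      · intro j hj1 hj2
        have := hlt j hj1 hj2
        rw [List.getElem?_append_left this] at hj2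
        exact h3 _ at_lt_top hj2

/-- A `Y`-instruction inside the left factor. -/
theorem prev_left {A : Type*} (Y : YInstr A) (u v : List A) (p : Pos) (hp : p < at' u.length) :
    Y.eval (u ++ v) p = Y.eval u p := by
  cases Y with
  | toStart => rfl
  | prev a =>
    have hget : ∀ j, at' j < p → (u ++ v)[j]? = u[j]? := by
      intro j hj
      exact List.getElem?_append_left (at_lt_at.1 (hj.trans hp))
    rcases prev_cases u p a with ⟨h1, h2⟩ | ⟨i, h1, h2, h3, h4⟩
    · rw [h2]
      exact prev_bot fun j hj => by rw [hget j hj]; exact h1 j hj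
    · rw [h4]
      refine prev_at h1 (by rw [hget i h1, h2]) fun j hj => ?_
      rw [hget j hj]
      exact h3 j hj

/-- Evaluating an `X`-ranker simultaneously on two products. -/
theorem xEval_append {A : Type*} {u u' : List A} (v v' : List A) (ρ : XRanker A)
    (hc : ∀ ρ', ρ' <+: ρ → (xEval ρ' u = ⊤ ↔ xEval ρ' u' = ⊤)) :
    (xEval ρ u ≠ ⊤ ∧ xEval ρ u' ≠ ⊤ ∧ xEval ρ (u ++ v) = xEval ρ u ∧
      xEval ρ (u' ++ v') = xEval ρ u') ∨
    (∃ ρ1, ρ1 ≠ [] ∧ ρ1 <:+ ρ ∧ xEval ρ (u ++ v) = shift u.length (xEval ρ1 v) ∧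
      xEval ρ (u' ++ v') = shift u'.length (xEval ρ1 v')) := by
  induction ρ using List.reverseRecOn with
  | nil => exact Or.inl (by simp)
  | append_singleton ρ X ih =>
    have hcX := hc (ρ ++ [X]) List.prefix_rfl
    rcases ih (fun ρ' h => hc ρ' (h.trans (List.prefix_append _ _))) with
      ⟨h1, h2, h3, h4⟩ | ⟨ρ1, h1, h2, h3, h4⟩
    · by_cases ht : xEval (ρ ++ [X]) u = ⊤
      · have ht' := hcX.1 ht
        refine Or.inr ⟨[X], by simp, List.suffix_append _ _, ?_, ?_⟩
        · rw [xEval_snoc] at ht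
          rw [xEval_snoc, h3, next_cross X u v _ (xEval_lt ρ u h1) ht]
          rfl
        · rw [xEval_snoc] at ht'
          rw [xEval_snoc, h4, next_cross X u' v' _ (xEval_lt ρ u' h2) ht']
          rfl
      · have ht' := fun h => ht (hcX.2 h)
        refine Or.inl ⟨ht, ht', ?_, ?_⟩
        · rw [xEval_snoc] at ht
          rw [xEval_snoc, xEval_snoc, h3, next_left X u v _ ht]
        · rw [xEval_snoc] at ht'
          rw [xEval_snoc, xEval_snoc, h4, next_left X u' v' _ ht']
    · refine Or.inr ⟨ρ1 ++ [X], by simp, ?_, ?_, ?_⟩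
      · obtain ⟨t, rfl⟩ := h2
        exact ⟨t, by simp⟩
      · rw [xEval_snoc, xEval_snoc, h3, next_right X u v _ (xEval_ne_bot h1 v)]
      · rw [xEval_snoc, xEval_snoc, h4, next_right X u' v' _ (xEval_ne_bot h1 v')]

/-- Evaluating a `Y`-ranker simultaneously on two products. -/
theorem yEval_append {A : Type*} (u u' : List A) {v v' : List A} (l : YRanker A)
    (hc : ∀ l', l' <+: l → (yEval l' v = ⊥ ↔ yEval l' v' = ⊥)) :
    (yEval l v ≠ ⊥ ∧ yEval l v' ≠ ⊥ ∧ yEval l (u ++ v) = shift u.length (yEval l v) ∧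
      yEval l (u' ++ v') = shift u'.length (yEval l v')) ∨
    (∃ l1, l1 ≠ [] ∧ l1 <:+ l ∧ yEval l (u ++ v) = yEval l1 u ∧
      yEval l (u' ++ v') = yEval l1 u') := by
  induction l using List.reverseRecOn with
  | nil => exact Or.inl (by simp)
  | append_singleton l Y ih =>
    have hcY := hc (l ++ [Y]) List.prefix_rfl
    rcases ih (fun l' h => hc l' (h.trans (List.prefix_append _ _))) with
      ⟨h1, h2, h3, h4⟩ | ⟨l1, h1, h2, h3, h4⟩
    · by_cases ht : yEval (l ++ [Y]) v = ⊥
      · have ht' := hcY.1 ht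
        refine Or.inr ⟨[Y], by simp, List.suffix_append _ _, ?_, ?_⟩
        · rw [yEval_snoc] at ht
          rw [yEval_snoc, h3, prev_cross Y u v _ h1 ht]
          rfl
        · rw [yEval_snoc] at ht'
          rw [yEval_snoc, h4, prev_cross Y u' v' _ h2 ht']
          rfl
      · have ht' := fun h => ht (hcY.2 h)
        refine Or.inl ⟨ht, ht', ?_, ?_⟩
        · rw [yEval_snoc] at ht
          rw [yEval_snoc, yEval_snoc, h3, prev_right Y u v _ ht]
        · rw [yEval_snoc] at ht'
          rw [yEval_snoc, yEval_snoc, h4, prev_right Y u' v' _ ht']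
    · refine Or.inr ⟨l1 ++ [Y], by simp, ?_, ?_, ?_⟩
      · obtain ⟨t, rfl⟩ := h2
        exact ⟨t, by simp⟩
      · rw [yEval_snoc, yEval_snoc, h3, prev_left Y u v _ (yEval_lt l1 u (yEval_ne_top h1 u))]
      · rw [yEval_snoc, yEval_snoc, h4, prev_left Y u' v' _ (yEval_lt l1 u' (yEval_ne_top h1 u'))]

theorem between_append {A : Type*} (u v : List A) (p q p1 q1 p2 q2 : Pos)
    (h1 : ∀ i < u.length, (p < at' i ∧ at' i < q ↔ p1 < at' i ∧ at' i < q1))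
    (h2 : ∀ i, (p < at' (u.length + i) ∧ at' (u.length + i) < q ↔ p2 < at' i ∧ at' i < q2)) :
    between (u ++ v) p q = between u p1 q1 ++ between v p2 q2 := by
  classical
  unfold between
  rw [List.zipIdx_append, List.filter_append, List.map_append]
  congr 1
  · congr 1
    apply List.filter_congr
    rintro ⟨a, i⟩ hx
    have := List.snd_lt_of_mem_zipIdx hx
    simp only [decide_eq_decide]
    exact h1 i (by simpa using this)
  · rw [Nat.zero_add, List.zipIdx_eq_map_add, List.filter_map, List.map_map]
    congr 1
    apply List.filter_congr
    rintro ⟨a, i⟩ _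
    simp only [Function.comp, decide_eq_decide]
    exact h2 i

theorem between_self {A : Type*} (w : List A) (p : Pos) : between w p p = [] := by
  classical
  unfold between
  rw [List.map_eq_nil_iff, List.filter_eq_nil_iff]
  intro x _
  simp only [decide_eq_true_eq, not_and]
  exact fun h => h.not_gt

theorem between_bot_top {A : Type*} (w : List A) : between w ⊥ ⊤ = w := by
  classical
  unfold between
  rw [List.filter_eq_self.2]
  · simp
  · intro x _
    simp

/-- The pairs of prefixes that `≈_{m,n}` talks about. -/
def Valid {A : Type*} (n : ℕ) (ρ' : XRanker A) (l' : YRanker A) : Prop :=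
  ∃ (ρ : XRanker A) (l : YRanker A), ρ.length + l.length ≤ n ∧ ρ' <+: ρ ++ [XInstr.toEnd] ∧
    l' <+: l ++ [YInstr.toStart]

theorem suffix_aux {B : Type*} {r' r s : List B} {e : B} (h : r' <+: r ++ [e]) (hs : s <:+ r') :
    ∃ t : List B, t.length ≤ r.length ∧ s <+: t ++ [e] := by
  obtain ⟨x, rfl⟩ := hs
  obtain ⟨y, hy⟩ := h
  by_cases hx : x.length ≤ r.length
  · refine ⟨r.drop x.length, by simp, y, ?_⟩
    rw [← List.drop_append_of_le_length hx, ← hy, List.append_assoc, List.drop_left]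
  · have := congrArg List.length hy
    simp only [List.length_append, List.length_singleton] at this
    have hs : s = [] := List.eq_nil_of_length_eq_zero (by omega)
    exact ⟨r, le_rfl, by simp [hs]⟩

theorem Valid.suffix {A : Type*} {n : ℕ} {ρ' ρ1 : XRanker A} {l' l1 : YRanker A}
    (h : Valid n ρ' l') (hx : ρ1 <:+ ρ') (hy : l1 <:+ l') : Valid n ρ1 l1 := by
  obtain ⟨ρ, l, hn, h1, h2⟩ := h
  obtain ⟨s, hs, hs'⟩ := suffix_aux h1 hx
  obtain ⟨t, ht, ht'⟩ := suffix_aux h2 hy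
  exact ⟨s, t, by omega, hs', ht'⟩

theorem Valid.prefix {A : Type*} {n : ℕ} {ρ' ρ1 : XRanker A} {l' l1 : YRanker A}
    (h : Valid n ρ' l') (hx : ρ1 <+: ρ') (hy : l1 <+: l') : Valid n ρ1 l1 := by
  obtain ⟨ρ, l, hn, h1, h2⟩ := h
  exact ⟨ρ, l, hn, hx.trans h1, hy.trans h2⟩

/-- The condition on the splits for one pair of rankers. -/
def SplitCond {A : Type*} (m : ℕ) (ρ : XRanker A) (l : YRanker A) (u v : List A) : Prop :=
  alph (middlePart ρ l u) = alph (middlePart ρ l v) ∧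
  ∀ a, a ∉ alph (middlePart ρ l u) →
    cnt a (leftPart ρ u) ≡ cnt a (leftPart ρ v) [MOD m] ∧
    cnt a (rightPart l u) ≡ cnt a (rightPart l v) [MOD m]

theorem approx_iff {A : Type*} {m n : ℕ} {u v : List A} :
    Approx m n u v ↔ ∀ ρ l, Valid n ρ l → ord ρ l u = ord ρ l v ∧
      (xEval ρ u ≤ yEval l u → SplitCond m ρ l u v) := by
  constructor
  · rintro h ρ' l' ⟨ρ, l, hn, h1, h2⟩
    have hc := (h ρ l hn).1 ρ' l' h1 h2
    exact ⟨hc, fun hle => (h ρ l hn).2 ρ' l' h1 h2 hle ((le_iff_of_ord hc).1 hle)⟩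
  · intro h ρ l hn
    exact ⟨fun ρ' l' h1 h2 => (h ρ' l' ⟨ρ, l, hn, h1, h2⟩).1,
      fun ρ' l' h1 h2 hle _ => (h ρ' l' ⟨ρ, l, hn, h1, h2⟩).2 hle⟩

theorem Approx.cnt {A : Type*} {m n : ℕ} {u v : List A} (h : Approx m n u v) (a : A) :
    cnt a u ≡ cnt a v [MOD m] := by
  have hv : Valid n [XInstr.toEnd] ([] : YRanker A) :=
    ⟨[], [], by simp, by simp, by simp⟩
  have e : ∀ w : List A, xEval [XInstr.toEnd] w = ⊤ := fun _ => rfl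
  have := ((approx_iff.1 h _ _ hv).2 (by simp [e])).2 a
    (by simp [alph, middlePart, e, between_self])
  simpa [leftPart, e, between_bot_top] using this.1

theorem alph_append {A : Type*} (u v : List A) : alph (u ++ v) = alph u ∪ alph v := by
  ext a; simp [alph]

theorem cnt_append {A : Type*} (a : A) (u v : List A) : cnt a (u ++ v) = cnt a u + cnt a v := by
  simp [DAb.cnt]

theorem split_left {A : Type*} {u v : List A} {p q : Pos} (hp : p < at' u.length)
    (hq : q < at' u.length) :
    between (u ++ v) ⊥ p = between u ⊥ p ∧ between (u ++ v) p q = between u p q ∧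
    between (u ++ v) q ⊤ = between u q ⊤ ++ v := by
  have far : ∀ {r : Pos}, r < at' u.length → ∀ i, ¬ at' (u.length + i) < r := by
    intro r hr i h
    have := h.trans hr
    simp at this
  have near : ∀ {r : Pos}, r < at' u.length → ∀ i, r < at' (u.length + i) :=
    fun hr i => hr.trans_le (by simp)
  refine ⟨?_, ?_, ?_⟩
  · rw [between_append u v ⊥ p ⊥ p ⊥ ⊥ (fun _ _ => Iff.rfl) (by simp [far hp]), between_self,
      List.append_nil]
  · rw [between_append u v p q p q ⊥ ⊥ (fun _ _ => Iff.rfl) (by simp [far hq]), between_self,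
      List.append_nil]
  · rw [between_append u v q ⊤ q ⊤ ⊥ ⊤ (fun _ _ => Iff.rfl) (by simp [near hq]), between_bot_top]

theorem shift_lt {k i : ℕ} {p : Pos} : at' (k + i) < shift k p ↔ at' i < p := by
  rcases pos_cases p with rfl | rfl | ⟨j, rfl⟩ <;> simp

theorem lt_shift {k i : ℕ} {p : Pos} : shift k p < at' (k + i) ↔ p < at' i := by
  rcases pos_cases p with rfl | rfl | ⟨j, rfl⟩ <;> simp

theorem at_lt_shift {k i : ℕ} {p : Pos} (hp : p ≠ ⊥) (hi : i < k) : at' i < shift k p := by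
  rcases pos_cases p with rfl | rfl | ⟨j, rfl⟩
  · exact (hp rfl).elim
  · simp
  · simp; omega

theorem split_right {A : Type*} {u v : List A} {p q : Pos} (hp : p ≠ ⊥) (hq : q ≠ ⊥) :
    between (u ++ v) ⊥ (shift u.length p) = u ++ between v ⊥ p ∧
    between (u ++ v) (shift u.length p) (shift u.length q) = between v p q ∧
    between (u ++ v) (shift u.length q) ⊤ = between v q ⊤ := by
  refine ⟨?_, ?_, ?_⟩
  · rw [between_append u v ⊥ _ ⊥ ⊤ ⊥ p (fun i hi => by simp [at_lt_shift hp hi])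
      (by simp [shift_lt]), between_bot_top]
  · rw [between_append u v _ _ ⊥ ⊥ p q (fun i hi => by simp [(at_lt_shift hp hi).not_gt])
      (by simp [shift_lt, lt_shift]), between_self, List.nil_append]
  · rw [between_append u v _ _ ⊥ ⊥ q ⊤ (fun i hi => by simp [(at_lt_shift hq hi).not_gt])
      (by simp [lt_shift]), between_self, List.nil_append]

theorem split_cross {A : Type*} {u v : List A} {p q : Pos} (hp : p < at' u.length) (hq : q ≠ ⊥) :
    between (u ++ v) ⊥ p = between u ⊥ p ∧
    between (u ++ v) p (shift u.length q) = between u p ⊤ ++ between v ⊥ q ∧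
    between (u ++ v) (shift u.length q) ⊤ = between v q ⊤ := by
  refine ⟨(split_left hp hp).1, ?_, (split_right hq hq).2.2⟩
  refine between_append u v _ _ p ⊤ ⊥ q (fun i hi => by simp [at_lt_shift hq hi]) fun i => ?_
  have : p < at' (u.length + i) := hp.trans_le (by simp)
  simp [this, shift_lt]

theorem Approx.append {A : Type*} {m n : ℕ} {u u' v v' : List A} (hu : Approx m n u u')
    (hv : Approx m n v v') : Approx m n (u ++ v) (u' ++ v') := by
  have hu' := approx_iff.1 hu
  have hv' := approx_iff.1 hv
  rw [approx_iff]
  intro ρ l hval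
  have hx : ∀ ρ', ρ' <+: ρ → (xEval ρ' u = ⊤ ↔ xEval ρ' u' = ⊤) := by
    intro ρ' h
    have := (hu' ρ' [] (hval.prefix h (List.nil_prefix))).1
    simpa using eq_iff_eq_of_cmp_eq_cmp this
  have hy : ∀ l', l' <+: l → (yEval l' v = ⊥ ↔ yEval l' v' = ⊥) := by
    intro l' h
    have := (hv' [] l' (hval.prefix (List.nil_prefix) h)).1
    simpa [eq_comm] using eq_iff_eq_of_cmp_eq_cmp this
  rcases xEval_append v v' ρ hx with ⟨a1, a2, a3, a4⟩ | ⟨ρ1, a1, a2, a3, a4⟩ <;>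
  rcases yEval_append u u' l hy with ⟨b1, b2, b3, b4⟩ | ⟨l1, b1, b2, b3, b4⟩
  · have p1 := xEval_lt ρ u a1
    have p2 := xEval_lt ρ u' a2
    obtain ⟨c1, c2, c3⟩ := split_cross (v := v) p1 b1
    obtain ⟨d1, d2, d3⟩ := split_cross (v := v') p2 b2
    have lt1 : ∀ (u : List A) (p q : Pos), p < at' u.length → q ≠ ⊥ → p < shift u.length q := by
      intro u p q h1 h2
      rcases pos_cases q with rfl | rfl | ⟨j, rfl⟩
      · exact (h2 rfl).elim
      · exact h1.trans at_lt_top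
      · exact h1.trans_le (by simp)
    refine ⟨?_, fun _ => ?_⟩
    · simp only [ord, a3, a4, b3, b4]
      rw [(cmp_eq_lt_iff _ _).2 (lt1 _ _ _ p1 b1), (cmp_eq_lt_iff _ _).2 (lt1 _ _ _ p2 b2)]
    · have e := (hu' ρ [] (hval.prefix List.prefix_rfl (List.nil_prefix))).2 (by simp)
      have f := (hv' [] l (hval.prefix (List.nil_prefix) List.prefix_rfl)).2 (by simp)
      simp only [SplitCond, middlePart, leftPart, rightPart, a3, a4, b3, b4, c1, c2, c3, d1, d2, d3,
        alph_append, xEval_nil, yEval_nil, Set.mem_union, not_or] at e f ⊢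
      exact ⟨by rw [e.1, f.1], fun a ha => ⟨(e.2 a ha.1).1, (f.2 a ha.2).2⟩⟩
  · have p1 := xEval_lt ρ u a1
    have p2 := xEval_lt ρ u' a2
    have q1 := yEval_lt l1 u (yEval_ne_top b1 u)
    have q2 := yEval_lt l1 u' (yEval_ne_top b1 u')
    obtain ⟨c1, c2, c3⟩ := split_left (v := v) p1 q1
    obtain ⟨d1, d2, d3⟩ := split_left (v := v') p2 q2
    have e := hu' ρ l1 (hval.suffix List.suffix_rfl b2)
    refine ⟨?_, fun hle => ?_⟩
    · simp only [ord, a3, a4, b3, b4]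
      exact e.1
    · rw [a3, b3] at hle
      have e := e.2 hle
      simp only [SplitCond, middlePart, leftPart, rightPart, a3, a4, b3, b4, c1, c2, c3, d1, d2, d3,
        cnt_append] at e ⊢
      exact ⟨e.1, fun a ha => ⟨(e.2 a ha).1, (e.2 a ha).2.add (hv.cnt a)⟩⟩
  · have p1 := xEval_ne_bot a1 v
    have p2 := xEval_ne_bot a1 v'
    obtain ⟨c1, c2, c3⟩ := split_right (u := u) (v := v) p1 b1
    obtain ⟨d1, d2, d3⟩ := split_right (u := u') (v := v') p2 b2
    have e := hv' ρ1 l (hval.suffix a2 List.suffix_rfl)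
    have o := e.1
    simp only [ord] at o
    refine ⟨?_, fun hle => ?_⟩
    · simp only [ord, a3, a4, b3, b4, cmp_shift]
      exact o
    · rw [a3, b3] at hle
      have e := e.2 ((le_iff_le_of_cmp_eq_cmp (cmp_shift _ _)).1 hle)
      simp only [SplitCond, middlePart, leftPart, rightPart, a3, a4, b3, b4, c1, c2, c3, d1, d2, d3,
        cnt_append] at e ⊢
      exact ⟨e.1, fun a ha => ⟨(hu.cnt a).add (e.2 a ha).1, (e.2 a ha).2⟩⟩
  · have gt1 : ∀ w z : List A, yEval l1 w < shift w.length (xEval ρ1 z) := by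
      intro w z
      have h1 := yEval_lt l1 w (yEval_ne_top b1 w)
      rcases pos_cases (xEval ρ1 z) with h | h | ⟨j, h⟩
      · exact (xEval_ne_bot a1 z h).elim
      · rw [h]; exact h1.trans at_lt_top
      · rw [h]; exact h1.trans_le (by simp)
    refine ⟨?_, fun hle => ?_⟩
    · simp only [ord, a3, a4, b3, b4]
      rw [(cmp_eq_gt_iff _ _).2 (gt1 u v), (cmp_eq_gt_iff _ _).2 (gt1 u' v')]
    · rw [a3, b3] at hle
      exact (hle.not_gt (gt1 u v)).elim

/-- The word (list of letters) of an element of the free semigroup `Σ⁺`. -/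
def word {A : Type*} (w : FreeSemigroup A) : List A := w.head :: w.tail

theorem word_mul {A : Type*} (u v : FreeSemigroup A) : word (u * v) = word u ++ word v := by
  simp [word]

/-- The congruence `≈_{m,n}` on the free semigroup `Σ⁺`; its quotient is `Σ⁺ / ≈_{m,n}`. -/
def approxCon (A : Type*) (m n : ℕ) : Con (FreeSemigroup A) where
  r u v := Approx m n (word u) (word v)
  iseqv := ⟨fun u => Approx.refl m n _, fun h => h.symm, fun h k => h.trans k⟩
  mul' h k := by rw [word_mul, word_mul]; exact h.append k

/-! ### Green's relations and finite semigroups whose regular `𝒟`-classes are Abelian groups -/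

/-- Green's relation `ℒ` of a semigroup `S`; `WithOne S` is `S¹ = S ∪ {1}`. -/
def GreenL {S : Type*} [Semigroup S] (s t : S) : Prop :=
  ∃ x x' : WithOne S, x * (s : WithOne S) = t ∧ (s : WithOne S) = x' * t

/-- Green's relation `ℛ`. -/
def GreenR {S : Type*} [Semigroup S] (s t : S) : Prop :=
  ∃ y y' : WithOne S, (s : WithOne S) * y = t ∧ (s : WithOne S) = t * y'

/-- Green's relation `𝒟`: two elements are related if they are connected by a finite chain of
`ℒ`- and `ℛ`-related elements. -/
def GreenD {S : Type*} [Semigroup S] (s t : S) : Prop :=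
  Relation.ReflTransGen (fun a b => GreenL a b ∨ GreenR a b) s t

/-- A subset of a semigroup that forms an Abelian group under the multiplication of the
semigroup. -/
def FormsAbelianGroup {S : Type*} [Semigroup S] (D : Set S) : Prop :=
  (∀ s ∈ D, ∀ t ∈ D, s * t ∈ D) ∧ (∀ s ∈ D, ∀ t ∈ D, s * t = t * s) ∧
  ∃ e ∈ D, (∀ s ∈ D, e * s = s) ∧ ∀ s ∈ D, ∃ t ∈ D, t * s = e

/-- `S` is a finite semigroup each of whose regular `𝒟`-classes (those that contain an idempotent)
forms an Abelian group. -/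
def IsDAbS (S : Type*) [Semigroup S] : Prop :=
  Finite S ∧ ∀ s : S, (∃ e : S, GreenD s e ∧ IsIdempotentElem e) →
    FormsAbelianGroup {t : S | GreenD s t}

end DAb

namespace DAb

/-! Let `M` be S with a neutral element adjoined.

From abelian classes to rankers: choose `m` such that all `m`-th powers in `M` are idempotent. If a
letter `a` is a factor of an idempotent `e`, then `e` commutes with `a`, such letters commute with
each other below `e`, and `e * a ^ m = e`; this is `LocallyAbelian`. Read a word u from the left. As
long as the value of the prefix stays in one ℛ-class, the prefix value is fixed by an idempotent of
which all letters read are factors, so the block read may be replaced by any word over its letters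
with the same counts modulo `m`. A letter that leaves the ℛ-class is new in its block, so an
instruction `X_a` lands on it. The ℛ-descents of u thus give an X-ranker α of length at most |M|,
and dually the ℒ-descents of v give a Y-ranker β of length at most |M|. If u ≈ v for rankers of
total length 2|M|, then α and β mark both words in the same order and with matching splits.
`MarksAgree.exists_follows` merges the two factorizations: it constructs one word Z that is obtained
from u by permitted replacements in the α-blocks and from v by permitted replacements in the
β-blocks. Hence u, Z and v have the same value (`LocallyAbelian.wordVal_eq`), and the evaluation of
words factors through ≈.

From rankers to abelian classes: in a high power of a word w, the X-rankers and Y-rankers of bounded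
length over its letters stop near opposite ends and leave a whole copy of w between them. So ≈
cannot see the order or the place of further letters of w put next to that power, only how many
there are. If w maps to an idempotent `e`, then the factors of `e` commute with `e` and with each
other below `e` (`FactorsCommute`). This makes the 𝒟-class of `e` the group of units of eSe and
makes that group abelian. Finiteness holds since ≈ has finitely many classes over a finite alphabet.
-/

/-! ### Words with positions numbered from zero -/

/-- The letters of `w` strictly between positions `p` and `q`, where `0` is the position before the
first letter and `w.length + 1` the position after the last letter. -/
def block {A : Type*} (w : List A) (p q : ℕ) : List A := (w.take (q - 1)).drop p

/-- The number of a position of `w`. -/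
def posVal {A : Type*} (w : List A) : Pos → ℕ
  | none => 0
  | some none => w.length + 1
  | some (some i) => i + 1

@[simp] theorem posVal_bot {A : Type*} (w : List A) : posVal w ⊥ = 0 := rfl
@[simp] theorem posVal_top {A : Type*} (w : List A) : posVal w ⊤ = w.length + 1 := rfl
@[simp] theorem posVal_at {A : Type*} (w : List A) (i : ℕ) : posVal w (at' i) = i + 1 := rfl

theorem map_fst_filter_zipIdx {A : Type*} (w : List A) (k lo hi : ℕ) :
    ((w.zipIdx k).filter (fun x => decide (lo ≤ x.2 ∧ x.2 < hi))).map Prod.fst =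
      (w.take (hi - k)).drop (lo - k) := by
  induction w generalizing k with
  | nil => simp
  | cons a w ih =>
    rw [List.zipIdx_cons, List.filter_cons]
    by_cases h1 : k < hi
    · obtain ⟨d, hd⟩ : ∃ d, hi - k = d + 1 := ⟨hi - k - 1, by omega⟩
      have hd' : hi - (k + 1) = d := by omega
      by_cases h2 : lo ≤ k
      · have : lo - k = 0 := by omega
        have h3 : lo - (k + 1) = 0 := by omega
        have ih := ih (k + 1)
        simp only [Bool.decide_and] at ih
        simp [h1, h2, ih, hd, hd', this, h3]
      · obtain ⟨e, he⟩ : ∃ e, lo - k = e + 1 := ⟨lo - k - 1, by omega⟩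
        have he' : lo - (k + 1) = e := by omega
        have ih := ih (k + 1)
        simp only [Bool.decide_and] at ih
        simp [h2, ih, hd, hd', he, he']
    · have h3 : hi - k = 0 := by omega
      have h4 : hi - (k + 1) = 0 := by omega
      have ih := ih (k + 1)
      rw [h4, List.take_zero, List.drop_nil] at ih
      rw [if_neg (by simp [h1]), ih, h3, List.take_zero, List.drop_nil]

theorem between_eq_block {A : Type*} (w : List A) (p q : Pos) :
    between w p q = block w (posVal w p) (posVal w q) := by
  classical
  have := map_fst_filter_zipIdx w 0 (posVal w p) (posVal w q - 1)
  simp only [Nat.sub_zero] at this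
  rw [block, ← this, between]
  congr 1
  apply List.filter_congr
  rintro ⟨a, i⟩ hx
  have hi := List.snd_lt_of_mem_zipIdx hx
  simp only [decide_eq_decide]
  apply and_congr
  · rcases pos_cases p with rfl | rfl | ⟨j, rfl⟩
    · simp
    · simp only [not_top_lt, posVal_top, false_iff]; omega
    · simp only [at_lt_at, posVal_at]; omega
  · rcases pos_cases q with rfl | rfl | ⟨j, rfl⟩
    · simp
    · simpa using hi
    · simp

theorem cmp_posVal {A : Type*} {w : List A} {p q : Pos} (hp : p = ⊤ ∨ p < at' w.length)
    (hq : q = ⊤ ∨ q < at' w.length) : cmp (posVal w p) (posVal w q) = cmp p q := by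
  have mono : ∀ p q : Pos, (p = ⊤ ∨ p < at' w.length) → (q = ⊤ ∨ q < at' w.length) → p < q →
      posVal w p < posVal w q := by
    intro p q hp hq h
    rcases pos_cases p with rfl | rfl | ⟨i, rfl⟩ <;> rcases pos_cases q with rfl | rfl | ⟨j, rfl⟩ <;>
      simp_all
  rcases lt_trichotomy p q with h | rfl | h
  · rw [(cmp_eq_lt_iff _ _).2 h, (cmp_eq_lt_iff _ _).2 (mono _ _ hp hq h)]
  · simp
  · rw [(cmp_eq_gt_iff _ _).2 h, (cmp_eq_gt_iff _ _).2 (mono _ _ hq hp h)]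

theorem take_eq_append_block {A : Type*} (w : List A) {p q : ℕ} (h : p < q) :
    w.take (q - 1) = w.take p ++ block w p q := by
  rw [block]
  conv_lhs => rw [← List.take_append_drop p (w.take (q - 1))]
  rw [List.take_take, min_eq_left (by omega)]

theorem block_subset {A : Type*} (w : List A) {p q p' q' : ℕ} (h : p' ≤ p) (h' : q ≤ q') :
    alph (block w p q) ⊆ alph (block w p' q') := by
  intro a ha
  obtain ⟨i, hi⟩ := List.mem_iff_getElem?.1 ha
  refine List.mem_iff_getElem?.2 ⟨p - p' + i, ?_⟩
  have hlt : p + i < q - 1 := by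
    by_contra hge
    rw [block, List.getElem?_drop, List.getElem?_eq_none (by rw [List.length_take]; omega)] at hi
    cases hi
  rw [block, List.getElem?_drop, List.getElem?_take_of_lt hlt] at hi
  rw [block, List.getElem?_drop, List.getElem?_take_of_lt (by omega), ← hi]
  congr 1
  omega

theorem mem_block {A : Type*} {w : List A} {p q i : ℕ} {a : A} (h : p < i) (h' : i < q)
    (hi : w[i - 1]? = some a) : a ∈ alph (block w p q) := by
  refine List.mem_iff_getElem?.2 ⟨i - 1 - p, ?_⟩
  rw [block, List.getElem?_drop, List.getElem?_take_of_lt (by omega), ← hi]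
  congr 1
  omega

theorem block_eq_nil {A : Type*} (w : List A) {p q : ℕ} (h : q ≤ p + 1) : block w p q = [] := by
  simp only [block, List.drop_eq_nil_iff, List.length_take]
  omega

/-! ### Counting letters modulo `m` -/

/-- The numbers of occurrences of the letters in `w`, modulo `m`. -/
noncomputable def modCount {A : Type*} (m : ℕ) (w : List A) : A → ZMod m := fun a => (cnt a w : ZMod m)

@[simp] theorem modCount_nil {A : Type*} (m : ℕ) : modCount m ([] : List A) = 0 := by
  funext a; simp [modCount, cnt]

@[simp] theorem modCount_append {A : Type*} (m : ℕ) (u v : List A) :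
    modCount m (u ++ v) = modCount m u + modCount m v := by
  funext a; simp [modCount, cnt_append]

theorem cnt_eq_zero {A : Type*} {a : A} {w : List A} (h : a ∉ alph w) : cnt a w = 0 := by
  classical
  exact List.count_eq_zero.2 h

theorem modCount_eq_zero {A : Type*} {m : ℕ} {a : A} {w : List A} (h : a ∉ alph w) :
    modCount m w a = 0 := by
  simp [modCount, cnt_eq_zero h]

theorem modCount_take_eq {A : Type*} {m : ℕ} {w : List A} {p q : ℕ} {a : A} (h : p < q)
    (ha : a ∉ alph (block w p q)) : modCount m (w.take p) a = modCount m (w.take (q - 1)) a := by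
  rw [take_eq_append_block w h, modCount_append, Pi.add_apply, modCount_eq_zero ha, add_zero]

theorem modCount_take_succ {A : Type*} {m : ℕ} {w : List A} {p : ℕ} {a : A} (h : 1 ≤ p)
    (ha : w[p - 1]? = some a) :
    modCount m (w.take p) = modCount m (w.take (p - 1)) + modCount m [a] := by
  obtain ⟨p, rfl⟩ := Nat.exists_eq_add_of_le' h
  rw [Nat.add_sub_cancel] at ha ⊢
  rw [← modCount_append, List.take_add_one, ha, Option.toList_some]

/-- Every vector of residues supported on the letters of a word is the count of some word. -/
theorem exists_modCount_eq {A : Type*} {m : ℕ} [NeZero m] (w : List A) (d : A → ZMod m)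
    (h : ∀ a, a ∉ alph w → d a = 0) : ∃ z, alph z ⊆ alph w ∧ modCount m z = d := by
  classical
  induction w generalizing d with
  | nil => exact ⟨[], le_rfl, by funext a; simp [h a (by simp [alph])]⟩
  | cons b w ih =>
    -- The coordinate of `b` is zeroed so that the copies of `b` put in front supply all of it, even
    -- if `b` occurs again in `w`.
    obtain ⟨z, hz, hd⟩ := ih (Function.update d b 0) (by
      intro a ha
      by_cases hab : a = b
      · simp [hab]
      · rw [Function.update_of_ne hab]
        exact h a (by simpa [alph, hab] using ha))
    have hb : b ∉ alph z ∨ b ∈ alph w := by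
      by_cases hb : b ∈ alph z
      · exact Or.inr (hz hb)
      · exact Or.inl hb
    refine ⟨List.replicate (d b).val b ++ z, ?_, ?_⟩
    · intro a ha
      rcases List.mem_append.1 ha with ha | ha
      · rw [List.eq_of_mem_replicate ha]; simp [alph]
      · exact List.mem_cons_of_mem _ (hz ha)
    · rw [modCount_append, hd]
      funext a
      by_cases hab : a = b
      · subst hab
        simp [modCount, cnt]
      · simp [modCount, cnt, List.count_replicate, hab, Ne.symm hab]

/-! ### Words that follow the factorization of another word -/

/-- `p` lists `k` marked positions of `w` in increasing order, the `i`-th one having label `c i`,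
together with the positions before the first and after the last letter. -/
structure Marks {A : Type*} (w : List A) (k : ℕ) (c : ℕ → Option A) (p : ℕ → ℕ) : Prop where
  zero : p 0 = 0
  last : p (k + 1) = w.length + 1
  lt_succ : ∀ i ≤ k, p i < p (i + 1)
  label : ∀ i, 1 ≤ i → i ≤ k → w[p i - 1]? = c i

/-- The word `Z` follows the factorization of `w` at its last `d` marked positions, the first of
which is `p (i + 1)`: the blocks of `Z` only use letters of the corresponding blocks of `w`, and
the numbers of letters before a mark agree modulo `m`, `N` being what precedes `Z`. -/
def Follows {A : Type*} (m : ℕ) (w : List A) (p : ℕ → ℕ) :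
    ℕ → ℕ → (A → ZMod m) → List A → Prop
  | 0, i, N, Z => alph Z ⊆ alph (block w (p i) (p (i + 1))) ∧
      N + modCount m Z = modCount m (w.take (p (i + 1) - 1))
  | d + 1, i, N, Z => ∃ z a Z', Z = z ++ a :: Z' ∧ w[p (i + 1) - 1]? = some a ∧
      alph z ⊆ alph (block w (p i) (p (i + 1))) ∧
      N + modCount m z = modCount m (w.take (p (i + 1) - 1)) ∧
      Follows m w p d (i + 1) (modCount m (w.take (p (i + 1)))) Z'

/-- Letters before the first remaining mark only enter the running count. This is what allows a mark
of one factorization to be an ordinary letter in a block of the other. -/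
theorem Follows.append {A : Type*} {m : ℕ} {w : List A} {p : ℕ → ℕ} {d i : ℕ}
    {N : A → ZMod m} {Z : List A} (z : List A) (hz : alph z ⊆ alph (block w (p i) (p (i + 1))))
    (h : Follows m w p d i (N + modCount m z) Z) : Follows m w p d i N (z ++ Z) := by
  cases d with
  | zero =>
    refine ⟨?_, ?_⟩
    · rw [alph_append]; exact Set.union_subset hz h.1
    · rw [modCount_append, ← add_assoc]; exact h.2
  | succ d =>
    obtain ⟨z', a, Z', rfl, h1, h2, h3, h4⟩ := h
    refine ⟨z ++ z', a, Z', by simp, h1, ?_, ?_, h4⟩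
    · rw [alph_append]; exact Set.union_subset hz h2
    · rw [modCount_append, ← add_assoc]; exact h3

theorem Marks.le_of_le {A : Type*} {w : List A} {k : ℕ} {c : ℕ → Option A} {p : ℕ → ℕ}
    (h : Marks w k c p) {i j : ℕ} (hij : i ≤ j) (hj : j ≤ k + 1) : p i ≤ p j := by
  induction j, hij using Nat.le_induction with
  | base => exact le_rfl
  | succ j hj' ih => exact (ih (by omega)).trans (h.lt_succ j (by omega)).le

theorem Marks.exists_label {A : Type*} {w : List A} {k : ℕ} {c : ℕ → Option A} {p : ℕ → ℕ}
    (h : Marks w k c p) {i : ℕ} (h1 : 1 ≤ i) (hk : i ≤ k) :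
    1 ≤ p i ∧ ∃ a, c i = some a ∧ w[p i - 1]? = some a := by
  have e0 := h.lt_succ (i - 1) (by omega)
  rw [Nat.sub_add_cancel h1] at e0
  have e1 := h.lt_succ i hk
  have e2 := h.le_of_le (show i + 1 ≤ k + 1 by omega) le_rfl
  have e3 := h.last
  have hlt : p i - 1 < w.length := by omega
  refine ⟨by omega, w[p i - 1], ?_, List.getElem?_eq_getElem hlt⟩
  rw [← h.label i h1 hk, List.getElem?_eq_getElem hlt]

/-- The marks `p`, `q` in `u` and `p'`, `q'` in `v` are ordered in the same way, and the splits at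
these marks satisfy the conditions of `≈`. -/
structure MarksAgree {A : Type*} (m : ℕ) (u v : List A) (k l : ℕ) (p q p' q' : ℕ → ℕ) : Prop where
  cmp_eq : ∀ i ≤ k + 1, ∀ j ≤ l + 1, cmp (p i) (q j) = cmp (p' i) (q' j)
  alph_eq : ∀ i ≤ k + 1, ∀ j ≤ l + 1, p i ≤ q j →
    alph (block u (p i) (q j)) = alph (block v (p' i) (q' j))
  left_eq : ∀ i ≤ k + 1, ∀ j ≤ l + 1, p i ≤ q j → ∀ a, a ∉ alph (block u (p i) (q j)) →
    modCount m (u.take (p i - 1)) a = modCount m (v.take (p' i - 1)) a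
  right_eq : ∀ i ≤ k + 1, ∀ j ≤ l + 1, p i ≤ q j → ∀ a, a ∉ alph (block u (p i) (q j)) →
    modCount m (u.drop (q j)) a = modCount m (v.drop (q' j)) a

/-! ### Merging the factorizations of two equivalent words. -/

section Merge

variable {A : Type*} {m : ℕ} {u v : List A} {k l : ℕ} {c d : ℕ → Option A}
  {p q p' q' : ℕ → ℕ}

/-- The marked letter is the same in both words, so the counts still agree once it is included;
before the first letter both prefixes are empty. -/
theorem MarksAgree.left_succ (h : MarksAgree m u v k l p q p' q') (hp : Marks u k c p)
    (hp' : Marks v k c p') {i j : ℕ} (hi : i ≤ k) (hj : j ≤ l + 1) (hle : p i ≤ q j) {a : A}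
    (ha : a ∉ alph (block u (p i) (q j))) :
    modCount m (u.take (p i)) a = modCount m (v.take (p' i)) a := by
  rcases Nat.eq_zero_or_pos i with rfl | h1
  · simp [hp.zero, hp'.zero]
  · obtain ⟨e1, b, e2, e3⟩ := hp.exists_label h1 hi
    obtain ⟨f1, b', f2, f3⟩ := hp'.exists_label h1 hi
    obtain rfl : b = b' := Option.some.inj (e2.symm.trans f2)
    rw [modCount_take_succ e1 e3, modCount_take_succ f1 f3, Pi.add_apply, Pi.add_apply,
      h.left_eq i (by omega) j hj hle a ha]

/-- At the closing marks the split has an empty middle, so no letter is exempt from the count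
condition. -/
theorem MarksAgree.total (h : MarksAgree m u v k l p q p' q') (hp : Marks u k c p)
    (hq : Marks u l d q) (hp' : Marks v k c p') : modCount m u = modCount m v := by
  funext a
  have := h.left_eq (k + 1) le_rfl (l + 1) le_rfl (by rw [hp.last, hq.last]) a
    (by rw [block_eq_nil _ (by rw [hp.last, hq.last]; omega)]; simp [alph])
  simpa [hp.last, hp'.last] using this

/-- The count of the suffix is subtracted from the total count. -/
theorem MarksAgree.right_succ (h : MarksAgree m u v k l p q p' q') (hp : Marks u k c p)
    (hq : Marks u l d q) (hp' : Marks v k c p') {i j : ℕ} (hi : i ≤ k + 1) (hj : j ≤ l + 1)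
    (hle : p i ≤ q j) {a : A} (ha : a ∉ alph (block u (p i) (q j))) :
    modCount m (u.take (q j)) a = modCount m (v.take (q' j)) a := by
  have e := congrFun (h.total hp hq hp') a
  rw [← List.take_append_drop (q j) u, ← List.take_append_drop (q' j) v, modCount_append,
    modCount_append, Pi.add_apply, Pi.add_apply, h.right_eq i hi j hj hle a ha] at e
  exact add_right_cancel e

/-- The number of letters before the next mark if the last marks are `p i` and `q j`. -/
noncomputable def nextCount (m : ℕ) (u v : List A) (p q q' : ℕ → ℕ) (i j : ℕ) : A → ZMod m :=
  if p (i + 1) ≤ q (j + 1) then modCount m (u.take (p (i + 1) - 1))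
  else modCount m (v.take (q' (j + 1) - 1))

/-- The gap up to the next mark may only be filled with letters common to the current block of `u`
and the current block of `v`, so every other letter must already have its target count. There are
four cases, according to whether the last and the next mark come from `p` or from `q`. In each, the
letter is absent from a segment of one word, and the count is transferred to the other word at a
split whose middle lacks that letter. -/
theorem MarksAgree.nextCount_eq (h : MarksAgree m u v k l p q p' q') (hp : Marks u k c p)
    (hq : Marks u l d q) (hp' : Marks v k c p') (hq' : Marks v l d q') {i j : ℕ} (hi : i ≤ k)
    (hj : j ≤ l) (h1 : p i < q (j + 1)) (h2 : q j < p (i + 1)) {N : A → ZMod m}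
    (hN : (q j ≤ p i ∧ N = modCount m (u.take (p i))) ∨
      (p i ≤ q j ∧ N = modCount m (v.take (q' j)))) {a : A}
    (ha : a ∉ alph (block u (p i) (p (i + 1))) ∨ a ∉ alph (block v (q' j) (q' (j + 1)))) :
    N a = nextCount m u v p q q' i j a := by
  have pp := hp.lt_succ i hi
  have pp' := hp'.lt_succ i hi
  have qq := hq.lt_succ j hj
  have qq' := hq'.lt_succ j hj
  have h1' := (lt_iff_lt_of_cmp_eq_cmp (h.cmp_eq i (by omega) (j + 1) (by omega))).1 h1
  have h2' : q' j < p' (i + 1) := by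
    have := le_iff_le_of_cmp_eq_cmp (h.cmp_eq (i + 1) (by omega) j (by omega))
    by_contra hc
    exact absurd (this.2 (not_lt.1 hc)) (not_le.2 h2)
  have hge : q j ≤ p i → q' j ≤ p' i := by
    intro hh
    by_contra hc
    have := lt_iff_lt_of_cmp_eq_cmp (h.cmp_eq i (by omega) j (by omega))
    exact absurd (this.2 (not_le.1 hc)) (not_lt.2 hh)
  have hle : p i ≤ q j → p' i ≤ q' j :=
    (le_iff_le_of_cmp_eq_cmp (h.cmp_eq i (by omega) j (by omega))).1
  have nle : p (i + 1) ≤ q (j + 1) → p' (i + 1) ≤ q' (j + 1) :=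
    (le_iff_le_of_cmp_eq_cmp (h.cmp_eq (i + 1) (by omega) (j + 1) (by omega))).1
  have nge : ¬ p (i + 1) ≤ q (j + 1) → ¬ p' (i + 1) ≤ q' (j + 1) :=
    mt (le_iff_le_of_cmp_eq_cmp (h.cmp_eq (i + 1) (by omega) (j + 1) (by omega))).2
  have key := h.alph_eq i (by omega) (j + 1) (by omega) h1.le
  rw [nextCount]
  split_ifs with hn
  · have hn' := nle hn
    rcases hN with ⟨hx, rfl⟩ | ⟨hy, rfl⟩
    · refine modCount_take_eq pp ?_
      rcases ha with ha | ha
      · exact ha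
      · refine fun hc => ha (block_subset v (hge hx) le_rfl ?_)
        rw [← key]
        exact block_subset u le_rfl hn hc
    -- The last mark is a `q`, the next one a `p`. A letter missing in the block of `u` is
    -- transferred to `u` at the last mark; one missing in the block of `v` is transferred to `v` at
    -- the next mark.
    · rcases ha with ha | ha
      · rw [← h.right_succ hp hq hp' (i := i) (by omega) (by omega) hy
          fun hc => ha (block_subset u le_rfl h2.le hc)]
        exact modCount_take_eq h2 fun hc => ha (block_subset u hy le_rfl hc)
      · rw [h.left_eq (i + 1) (by omega) (j + 1) (by omega) hn]
        · exact modCount_take_eq h2' fun hc => ha (block_subset v le_rfl hn' hc)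
        · rw [h.alph_eq (i + 1) (by omega) (j + 1) (by omega) hn]
          exact fun hc => ha (block_subset v h2'.le le_rfl hc)
  · have hn' := not_le.1 (nge hn)
    rw [not_le] at hn
    rcases hN with ⟨hx, rfl⟩ | ⟨hy, rfl⟩
    -- The last mark is a `p`, the next one a `q`. Either hypothesis excludes the letter from the
    -- segment of `v` between these marks, and the transfer takes place at the last mark.
    · have hv : a ∉ alph (block v (p' i) (q' (j + 1))) := by
        rcases ha with ha | ha
        · rw [← key]
          exact fun hc => ha (block_subset u le_rfl hn.le hc)
        · exact fun hc => ha (block_subset v (hge hx) le_rfl hc)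
      rw [h.left_succ hp hp' hi (j := j + 1) (by omega) h1.le (by rwa [key])]
      exact modCount_take_eq h1' hv
    · refine modCount_take_eq qq' ?_
      rcases ha with ha | ha
      · refine fun hc => ha (block_subset u le_rfl hn.le ?_)
        rw [key]
        exact block_subset v (hle hy) le_rfl hc
      · exact ha

/-- There is a word that follows both the factorization of `u` at the marks `p` and the
factorization of `v` at the marks `q'`. -/
theorem MarksAgree.exists_follows_aux [NeZero m] (h : MarksAgree m u v k l p q p' q')
    (hp : Marks u k c p) (hq : Marks u l d q) (hp' : Marks v k c p') (hq' : Marks v l d q')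
    (D : ℕ) : ∀ s t i j : ℕ, s + t = D → i + s = k → j + t = l → p i < q (j + 1) →
    q j < p (i + 1) → ∀ N : A → ZMod m,
    ((q j ≤ p i ∧ N = modCount m (u.take (p i))) ∨
      (p i ≤ q j ∧ N = modCount m (v.take (q' j)))) →
    ∃ Z, Follows m u p s i N Z ∧ Follows m v q' t j N Z := by
  induction D using Nat.strong_induction_on with
  | _ D ih =>
  intro s t i j hD hs ht h1 h2 N hN
  have hi : i ≤ k := by omega
  have hj : j ≤ l := by omega
  classical
  -- `z` fills the gap up to the next mark: its letters lie in both current blocks, and its counts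
  -- make up the difference to the target, which vanishes at all other letters by `nextCount_eq`.
  obtain ⟨z, hz, hzc⟩ := exists_modCount_eq
    ((block u (p i) (p (i + 1))).filter fun a => a ∈ alph (block v (q' j) (q' (j + 1))))
    (nextCount m u v p q q' i j - N) (by
      intro a ha
      rw [Pi.sub_apply, sub_eq_zero]
      refine (h.nextCount_eq hp hq hp' hq' hi hj h1 h2 hN ?_).symm
      by_contra hc
      push Not at hc
      exact ha (List.mem_filter.2 ⟨hc.1, decide_eq_true hc.2⟩))
  have hzu : alph z ⊆ alph (block u (p i) (p (i + 1))) := fun a ha => (List.mem_filter.1 (hz ha)).1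
  have hzv : alph z ⊆ alph (block v (q' j) (q' (j + 1))) := fun a ha =>
    of_decide_eq_true (List.mem_filter.1 (hz ha)).2
  have hNz : N + modCount m z = nextCount m u v p q q' i j := by rw [hzc]; abel
  have hcmp := h.cmp_eq (i + 1) (by omega) (j + 1) (by omega)
  have pm := hp.le_of_le (show i + 1 ≤ k + 1 by omega) le_rfl
  have qm := hq.le_of_le (show j + 1 ≤ l + 1 by omega) le_rfl
  rw [hp.last] at pm
  rw [hq.last] at qm
  have hpi := hp.lt_succ i hi
  have hqj := hq.lt_succ j hj
  rcases lt_trichotomy (p (i + 1)) (q (j + 1)) with hlt | heq | hgt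
  · obtain ⟨s, rfl⟩ : ∃ s', s = s' + 1 := by
      rcases s with _ | s
      · have : i = k := by omega
        rw [this, hp.last] at hlt
        omega
      · exact ⟨s, rfl⟩
    have e := hp.lt_succ (i + 1) (by omega)
    obtain ⟨Z, hZ1, hZ2⟩ := ih (s + t) (by omega) s t (i + 1) j rfl (by omega) ht hlt (h2.trans e)
      _ (Or.inl ⟨h2.le, rfl⟩)
    obtain ⟨f1, b, f2, f3⟩ := hp.exists_label (show 1 ≤ i + 1 by omega) (by omega)
    rw [nextCount, if_pos hlt.le] at hNz
    refine ⟨z ++ b :: Z, ⟨z, b, Z, rfl, f3, hzu, hNz, hZ1⟩, ?_⟩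
    -- For `v` the letter `b` is no mark. It is an ordinary letter of the current block, because the
    -- corresponding mark `p' (i + 1)` lies strictly inside that block.
    rw [List.append_cons]
    refine Follows.append _ ?_ ?_
    · rw [alph_append]
      refine Set.union_subset hzv ?_
      intro b' hb'
      obtain rfl : b' = b := by simpa [alph] using hb'
      obtain ⟨g1, b'', g2, g3⟩ := hp'.exists_label (show 1 ≤ i + 1 by omega) (by omega)
      obtain rfl : b' = b'' := Option.some.inj (f2.symm.trans g2)
      refine mem_block (i := p' (i + 1)) ?_ ?_ g3
      · have := le_iff_le_of_cmp_eq_cmp (h.cmp_eq (i + 1) (by omega) j (by omega))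
        by_contra hc
        exact absurd (this.2 (not_lt.1 hc)) (not_le.2 h2)
      · exact (lt_iff_lt_of_cmp_eq_cmp hcmp).1 hlt
    · rw [modCount_append, ← add_assoc, hNz, ← modCount_take_succ f1 f3]
      exact hZ2
  -- The next marks coincide in both words. The split there has an empty middle, so `u` and `v` have
  -- the same counts of all letters before it, and one filler meets both targets.
  · have heq' := (eq_iff_eq_of_cmp_eq_cmp hcmp).1 heq
    have hnc : nextCount m u v p q q' i j = modCount m (u.take (p (i + 1) - 1)) := by
      rw [nextCount, if_pos heq.le]
    have hnil : block u (p (i + 1)) (q (j + 1)) = [] := block_eq_nil _ (by omega)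
    have hnc' : nextCount m u v p q q' i j = modCount m (v.take (q' (j + 1) - 1)) := by
      rw [hnc, ← heq']
      funext a
      exact h.left_eq (i + 1) (by omega) (j + 1) (by omega) heq.le a (by simp [hnil, alph])
    rcases s with _ | s
    · obtain rfl : i = k := by omega
      rcases t with _ | t
      · exact ⟨z, ⟨hzu, by rw [hNz, hnc]⟩, ⟨hzv, by rw [hNz, hnc']⟩⟩
      · have := hq.lt_succ (j + 1) (by omega)
        have := hq.le_of_le (show j + 1 + 1 ≤ l + 1 by omega) le_rfl
        have := hp.last
        have := hq.last
        omega
    · have e := hp.lt_succ (i + 1) (by omega)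
      have e' := hp.le_of_le (show i + 1 + 1 ≤ k + 1 by omega) le_rfl
      have e'' := hp.last
      obtain ⟨t, rfl⟩ : ∃ t', t = t' + 1 := by
        rcases t with _ | t
        · have : j = l := by omega
          rw [this, hq.last] at heq
          omega
        · exact ⟨t, rfl⟩
      have g := hq.lt_succ (j + 1) (by omega)
      obtain ⟨Z, hZ1, hZ2⟩ := ih (s + t) (by omega) s t (i + 1) (j + 1) rfl (by omega) (by omega)
        (by omega) (by omega) _ (Or.inl ⟨heq.ge, rfl⟩)
      obtain ⟨f1, b, f2, f3⟩ := hp.exists_label (show 1 ≤ i + 1 by omega) (by omega)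
      obtain ⟨g1, b', g2, g3⟩ := hp'.exists_label (show 1 ≤ i + 1 by omega) (by omega)
      obtain rfl : b = b' := Option.some.inj (f2.symm.trans g2)
      refine ⟨z ++ b :: Z, ⟨z, b, Z, rfl, f3, hzu, by rw [hNz, hnc], hZ1⟩,
        ⟨z, b, Z, rfl, by rwa [← heq'], hzv, by rw [hNz, hnc'], ?_⟩⟩
      rw [← heq']
      convert hZ2 using 1
      funext a
      exact (h.left_succ hp hp' (i := i + 1) (by omega) (j := j + 1) (by omega) heq.le
        (by simp [hnil, alph])).symm
  · obtain ⟨t, rfl⟩ : ∃ t', t = t' + 1 := by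
      rcases t with _ | t
      · have : j = l := by omega
        rw [this, hq.last] at hgt
        omega
      · exact ⟨t, rfl⟩
    have e := hq.lt_succ (j + 1) (by omega)
    obtain ⟨Z, hZ1, hZ2⟩ := ih (s + t) (by omega) s t i (j + 1) rfl hs (by omega) (h1.trans e) hgt
      _ (Or.inr ⟨h1.le, rfl⟩)
    obtain ⟨f1, b, f2, f3⟩ := hq'.exists_label (show 1 ≤ j + 1 by omega) (by omega)
    rw [nextCount, if_neg (not_le.2 hgt)] at hNz
    refine ⟨z ++ b :: Z, ?_, ⟨z, b, Z, rfl, f3, hzv, hNz, hZ2⟩⟩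
    rw [List.append_cons]
    refine Follows.append _ ?_ ?_
    · rw [alph_append]
      refine Set.union_subset hzu ?_
      intro b' hb'
      obtain rfl : b' = b := by simpa [alph] using hb'
      obtain ⟨g1, b'', g2, g3⟩ := hq.exists_label (show 1 ≤ j + 1 by omega) (by omega)
      obtain rfl : b' = b'' := Option.some.inj (f2.symm.trans g2)
      exact mem_block h1 hgt g3
    · rw [modCount_append, ← add_assoc, hNz, ← modCount_take_succ f1 f3]
      exact hZ1

theorem MarksAgree.exists_follows [NeZero m] (h : MarksAgree m u v k l p q p' q')
    (hp : Marks u k c p) (hq : Marks u l d q) (hp' : Marks v k c p') (hq' : Marks v l d q') :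
    ∃ Z, Follows m u p k 0 0 Z ∧ Follows m v q' l 0 0 Z := by
  have e1 := hp.lt_succ 0 (Nat.zero_le _)
  have e2 := hq.lt_succ 0 (Nat.zero_le _)
  refine h.exists_follows_aux hp hq hp' hq' (k + l) k l 0 0 rfl (by simp) (by simp) ?_ ?_ 0
    (Or.inl ⟨?_, ?_⟩)
  · rw [hq.zero] at e2; rwa [hp.zero]
  · rw [hp.zero] at e1; rwa [hq.zero]
  · rw [hp.zero, hq.zero]
  · simp [hp.zero]

end Merge

/-! ### Words acting on a monoid with Abelian regular classes -/

/-- The value of a word in a monoid. -/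
def wordVal {A M : Type*} [Monoid M] (g : A → M) (w : List A) : M := (w.map g).prod

section WordVal

variable {A M : Type*} [Monoid M] (g : A → M)

@[simp] theorem wordVal_nil : wordVal g [] = 1 := rfl

@[simp] theorem wordVal_cons (a : A) (w : List A) : wordVal g (a :: w) = g a * wordVal g w := by
  simp [wordVal]

@[simp] theorem wordVal_append (u v : List A) :
    wordVal g (u ++ v) = wordVal g u * wordVal g v := by
  simp [wordVal]

theorem wordVal_op (w : List A) :
    wordVal (fun a => MulOpposite.op (g a)) w.reverse = MulOpposite.op (wordVal g w) := by
  induction w with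
  | nil => rfl
  | cons a w ih => simp [ih]

theorem exists_eq_mul_of_mem {w : List A} {a : A} (h : a ∈ w) :
    ∃ x y, wordVal g w = x * g a * y := by
  obtain ⟨w1, w2, rfl⟩ := List.append_of_mem h
  exact ⟨wordVal g w1, wordVal g w2, by simp [mul_assoc]⟩

end WordVal

/-- The `m`-th powers are idempotent, and the letters of which an idempotent `e` is a multiple
commute with `e`, commute with each other below `e`, and have exponent `m` below `e`. -/
structure LocallyAbelian {A M : Type*} [Monoid M] (g : A → M) (m : ℕ) : Prop where
  idem : ∀ t : M, IsIdempotentElem (t ^ m)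
  comm : ∀ (e x y : M) (a : A), IsIdempotentElem e → e = x * g a * y → e * g a = g a * e
  comm₂ : ∀ (e x y x' y' : M) (a b : A), IsIdempotentElem e → e = x * g a * y →
    e = x' * g b * y' → e * (g a * g b) = e * (g b * g a)
  pow : ∀ (e x y : M) (a : A), IsIdempotentElem e → e = x * g a * y → e * g a ^ m = e

namespace LocallyAbelian

variable {A M : Type*} [Monoid M] {g : A → M} {m : ℕ}

-- The conditions are self-dual since the relevant letters commute with `e`. Statements on left
-- multiplication thus follow from those on right multiplication.
open MulOpposite in
theorem op (h : LocallyAbelian g m) : LocallyAbelian (fun a => op (g a)) m where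
  idem t := unop_injective (h.idem (unop t))
  comm e x y a he hx := by
    apply unop_injective
    refine (h.comm (unop e) (unop y) (unop x) a (congrArg unop he) ?_).symm
    rw [hx]; simp [mul_assoc]
  comm₂ e x y x' y' a b he hx hx' := by
    have e1 : unop e = unop y * g a * unop x := by rw [hx]; simp [mul_assoc]
    have e2 : unop e = unop y' * g b * unop x' := by rw [hx']; simp [mul_assoc]
    have he' : IsIdempotentElem (unop e) := congrArg unop he
    have c1 := h.comm _ _ _ _ he' e1
    have c2 := h.comm _ _ _ _ he' e2
    have c := h.comm₂ _ _ _ _ _ _ _ he' e1 e2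
    apply unop_injective
    simp only [unop_mul, unop_op]
    rw [mul_assoc, mul_assoc, ← c1, ← c2, ← mul_assoc, ← mul_assoc, ← c1, ← c2, mul_assoc,
      mul_assoc, c]
  pow e x y a he hx := by
    have e1 : unop e = unop y * g a * unop x := by rw [hx]; simp [mul_assoc]
    have he' : IsIdempotentElem (unop e) := congrArg unop he
    have c1 : Commute (unop e) (g a) := h.comm _ _ _ _ he' e1
    apply unop_injective
    simp only [unop_mul, unop_op, unop_pow]
    rw [← (c1.pow_right m).eq, h.pow _ _ _ _ he' e1]

/-- The idempotent is `(wordVal g w * y) ^ m`: it fixes `s` because its base does, and as `m` is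
positive every letter of `w` is a factor of it. -/
theorem exists_idempotent (h : LocallyAbelian g m) (hm : 1 ≤ m) {s y : M} {w : List A}
    (hs : s * wordVal g w * y = s) : ∃ e, IsIdempotentElem e ∧ s * e = s ∧
      ∀ a ∈ alph w, ∃ x y, e = x * g a * y := by
  refine ⟨(wordVal g w * y) ^ m, h.idem _, ?_, ?_⟩
  · have : ∀ k : ℕ, s * (wordVal g w * y) ^ k = s := by
      intro k
      induction k with
      | zero => simp
      | succ k ih => rw [pow_succ, ← mul_assoc, ih, ← mul_assoc, hs]
    exact this m
  · intro a ha
    obtain ⟨x', y', hx⟩ := exists_eq_mul_of_mem g ha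
    obtain ⟨k, rfl⟩ := Nat.exists_eq_add_of_le' hm
    exact ⟨x', y' * y * (wordVal g w * y) ^ k, by rw [pow_succ', hx]; simp only [mul_assoc]⟩

/-! ### Words over letters that are factors of a fixed idempotent. -/

section Below

variable {e : M} {W : Set A}

theorem mul_wordVal_mul (h : LocallyAbelian g m) (he : IsIdempotentElem e)
    (hW : ∀ a ∈ W, ∃ x y, e = x * g a * y) {s : M} (hs : s * e = s) {z : List A}
    (hz : alph z ⊆ W) : s * wordVal g z * e = s * wordVal g z := by
  induction z generalizing s with
  | nil => simpa using hs
  | cons a z ih =>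
    obtain ⟨x, y, hx⟩ := hW a (hz (by simp [alph]))
    rw [wordVal_cons, ← mul_assoc]
    refine ih ?_ fun b hb => hz (List.mem_cons_of_mem _ hb)
    rw [mul_assoc, ← h.comm e x y a he hx, ← mul_assoc, hs]

/-- Each letter can be undone from the right by its power `m - 1`, since `e * g a ^ m = e`.
Multiplying by such letters therefore never leaves the ℛ-class of `s`. -/
theorem exists_mul_eq (h : LocallyAbelian g m) (hm : 1 ≤ m) (he : IsIdempotentElem e)
    (hW : ∀ a ∈ W, ∃ x y, e = x * g a * y) {s : M} (hs : s * e = s) {z : List A}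
    (hz : alph z ⊆ W) : ∃ y, s * wordVal g z * y = s := by
  induction z using List.reverseRecOn with
  | nil => exact ⟨1, by simp⟩
  | append_singleton z a ih =>
    have hz' : alph z ⊆ W := fun b hb => hz (List.mem_append_left _ hb)
    obtain ⟨y, hy⟩ := ih hz'
    obtain ⟨x, x', hx⟩ := hW a (hz (by simp [alph]))
    obtain ⟨k, rfl⟩ := Nat.exists_eq_add_of_le' hm
    have c := h.mul_wordVal_mul he hW hs hz'
    refine ⟨g a ^ k * y, ?_⟩
    calc s * wordVal g (z ++ [a]) * (g a ^ k * y) = s * wordVal g z * g a ^ (k + 1) * y := by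
          rw [pow_succ']; simp [mul_assoc]
      _ = s * wordVal g z * (e * g a ^ (k + 1)) * y := by rw [← mul_assoc, c]
      _ = s := by rw [h.pow e x x' a he hx, c, hy]

/-- Adjacent letters can be exchanged because `s` absorbs `e`, below which they commute. The
idempotent moves along with the prefix by `mul_wordVal_mul`. -/
theorem mul_wordVal_perm (h : LocallyAbelian g m) (he : IsIdempotentElem e)
    (hW : ∀ a ∈ W, ∃ x y, e = x * g a * y) {s : M} (hs : s * e = s) {z z' : List A}
    (hz : alph z ⊆ W) (hp : z.Perm z') : s * wordVal g z = s * wordVal g z' := by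
  have step : ∀ {s : M} {a : A}, s * e = s → a ∈ W → s * g a * e = s * g a := by
    intro s a hs ha
    simpa using h.mul_wordVal_mul he hW hs (z := [a]) (by simpa [alph] using ha)
  induction hp generalizing s with
  | nil => rfl
  | cons a _ ih =>
    rw [wordVal_cons, wordVal_cons, ← mul_assoc, ← mul_assoc]
    exact ih (step hs (hz (by simp [alph]))) fun b hb => hz (List.mem_cons_of_mem _ hb)
  | swap a b z =>
    obtain ⟨x, y, hx⟩ := hW a (hz (by simp [alph]))
    obtain ⟨x', y', hx'⟩ := hW b (hz (by simp [alph]))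
    have c := h.comm₂ e x' y' x y b a he hx' hx
    simp only [wordVal_cons]
    calc s * (g b * (g a * wordVal g z)) = s * (e * (g b * g a)) * wordVal g z := by
          rw [← mul_assoc s e, hs]; simp only [mul_assoc]
      _ = s * (g a * (g b * wordVal g z)) := by
          rw [c, ← mul_assoc s e, hs]; simp only [mul_assoc]
  | trans h1 _ ih1 ih2 =>
    exact (ih1 hs hz).trans (ih2 hs fun b hb => hz (h1.mem_iff.2 hb))

/-- In a nonempty word whose counts are all divisible by `m`, the first letter occurs at least `m`
times. Those `m` copies can be moved to the front and cancelled, leaving a shorter word of the same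
kind. -/
theorem mul_wordVal_eq_self (h : LocallyAbelian g m) (hm : 1 ≤ m) (he : IsIdempotentElem e)
    (hW : ∀ a ∈ W, ∃ x y, e = x * g a * y) {s : M} (hs : s * e = s) {z : List A}
    (hz : alph z ⊆ W) (hc : modCount m z = 0) : s * wordVal g z = s := by
  classical
  induction hl : z.length using Nat.strong_induction_on generalizing z with
  | _ n ih =>
  rcases z with _ | ⟨a, z⟩
  · simp
  have hd : ∀ b, m ∣ (a :: z).count b := by
    intro b
    have := congrFun hc b
    rw [modCount, Pi.zero_apply, ZMod.natCast_eq_zero_iff] at this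
    exact this
  have hle : m ≤ (a :: z).count a := Nat.le_of_dvd (by simp) (hd a)
  have hsub : List.Subperm (List.replicate m a) (a :: z) := by
    rw [List.subperm_ext_iff]
    intro b hb
    rw [List.eq_of_mem_replicate hb, List.count_replicate_self]
    exact hle
  obtain ⟨y, hy⟩ : ∃ y, (a :: z).Perm (List.replicate m a ++ y) := by
    obtain ⟨l, hl1, hl2⟩ := hsub
    obtain ⟨y, hy⟩ := hl2.exists_perm_append
    exact ⟨y, hy.trans (hl1.append_right y)⟩
  have hrep : wordVal g (List.replicate m a) = g a ^ m := by simp [wordVal]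
  obtain ⟨x, x', hx⟩ := hW a (hz (by simp [alph]))
  rw [h.mul_wordVal_perm he hW hs hz hy, wordVal_append, hrep, ← mul_assoc]
  conv_lhs => rw [← hs, mul_assoc s e, h.pow e x x' a he hx, hs]
  refine ih y.length ?_ (fun b hb => hz (hy.mem_iff.2 (List.mem_append_right _ hb))) ?_ rfl
  · rw [← hl, hy.length_eq, List.length_append, List.length_replicate]
    omega
  · funext b
    rw [modCount, Pi.zero_apply, ZMod.natCast_eq_zero_iff]
    have h1 := hd b
    rw [hy.count_eq, List.count_append] at h1
    have h2 : m ∣ (List.replicate m a).count b := by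
      rw [List.count_replicate]; split_ifs <;> simp
    have h3 := (Nat.dvd_add_right h2).1 h1
    exact h3

theorem mul_wordVal_congr (h : LocallyAbelian g m) (hm : 1 ≤ m) (he : IsIdempotentElem e)
    (hW : ∀ a ∈ W, ∃ x y, e = x * g a * y) {s : M} (hs : s * e = s) {z z' : List A}
    (hz : alph z ⊆ W) (hz' : alph z' ⊆ W) (hc : modCount m z = modCount m z') :
    s * wordVal g z = s * wordVal g z' := by
  -- With `m - 1` copies of `z'` as `y`, both `y ++ z'` and `z ++ y` have zero count. Thus `s z = s
  -- z y z' = s z'`.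
  have hrep : ∀ k : ℕ, alph (List.replicate k z').flatten ⊆ W ∧
      modCount m (List.replicate k z').flatten = (k : ZMod m) • modCount m z' := by
    intro k
    induction k with
    | zero => simp [alph]
    | succ k ih =>
      rw [List.replicate_succ, List.flatten_cons, alph_append, modCount_append]
      refine ⟨Set.union_subset hz' ih.1, ?_⟩
      rw [ih.2]; push_cast; rw [add_smul, one_smul, add_comm]
  obtain ⟨k, rfl⟩ := Nat.exists_eq_add_of_le' hm
  have hk : (k : ZMod (k + 1)) • modCount (k + 1) z' + modCount (k + 1) z' = 0 := by
    have : (k : ZMod (k + 1)) + 1 = 0 := by exact_mod_cast ZMod.natCast_self (k + 1)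
    calc _ = ((k : ZMod (k + 1)) + 1) • modCount (k + 1) z' := by rw [add_smul, one_smul]
      _ = 0 := by rw [this, zero_smul]
  obtain ⟨h1, h2⟩ := hrep k
  set y := (List.replicate k z').flatten
  have e1 : s * wordVal g (y ++ z') = s :=
    h.mul_wordVal_eq_self hm he hW hs (by rw [alph_append]; exact Set.union_subset h1 hz') (by
      rw [modCount_append, h2, hk])
  have e2 : s * wordVal g (z ++ y) = s :=
    h.mul_wordVal_eq_self hm he hW hs (by rw [alph_append]; exact Set.union_subset hz h1) (by
      rw [modCount_append, h2, hc, add_comm (modCount _ z'), hk])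
  have e3 := h.mul_wordVal_mul he hW hs hz
  have e4 : s * wordVal g z * wordVal g (y ++ z') = s * wordVal g z :=
    h.mul_wordVal_eq_self hm he hW e3 (by rw [alph_append]; exact Set.union_subset h1 hz') (by
      rw [modCount_append, h2, hk])
  rw [← e4, wordVal_append, ← mul_assoc, mul_assoc s, ← wordVal_append, e2]

end Below

/-- The first letter of a word that leaves the `ℛ`-class of `s`. -/
theorem exists_right_descent (h : LocallyAbelian g m) (hm : 1 ≤ m) (s : M) (u : List A) :
    (∀ z, alph z ⊆ alph u → modCount m z = modCount m u → s * wordVal g z = s * wordVal g u) ∨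
    ∃ u₀ a u₁, u = u₀ ++ a :: u₁ ∧ a ∉ alph u₀ ∧
      (∀ z, alph z ⊆ alph u₀ → modCount m z = modCount m u₀ →
        s * wordVal g z = s * wordVal g u₀) ∧
      ¬ ∃ y, s * (wordVal g u₀ * g a) * y = s := by
  have main : ∀ w : List A, (∃ y, s * wordVal g w * y = s) →
      (∀ z, alph z ⊆ alph w → modCount m z = modCount m w →
        s * wordVal g z = s * wordVal g w) := by
    rintro w ⟨y, hy⟩ z hz hc
    obtain ⟨e, he, hs, hW⟩ := h.exists_idempotent hm hy
    exact h.mul_wordVal_congr hm he hW hs hz le_rfl hc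
  -- The induction carries the return from `s * wordVal g u` to `s` by right multiplication; `main`
  -- turns this into the claim on replacements.
  suffices (∃ y, s * wordVal g u * y = s) ∨ ∃ u₀ a u₁, u = u₀ ++ a :: u₁ ∧ a ∉ alph u₀ ∧
      (∀ z, alph z ⊆ alph u₀ → modCount m z = modCount m u₀ →
        s * wordVal g z = s * wordVal g u₀) ∧
      ¬ ∃ y, s * (wordVal g u₀ * g a) * y = s from this.imp_left (main u)
  induction u using List.reverseRecOn with
  | nil => exact Or.inl ⟨1, by simp⟩
  | append_singleton u a ih =>
    rcases ih with hy | ⟨u₀, b, u₁, rfl, h1, h2, h3⟩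
    · by_cases hy' : ∃ y, s * wordVal g (u ++ [a]) * y = s
      · exact Or.inl hy'
      · refine Or.inr ⟨u, a, [], rfl, fun ha => hy' ?_, main u hy, by simpa using hy'⟩
        -- A letter that already occurred is a factor of the idempotent fixing `s`, so by
        -- `exists_mul_eq` it cannot leave the ℛ-class. Hence the descent letter is new.
        obtain ⟨y, hy⟩ := hy
        obtain ⟨e, he, hs, hW⟩ := h.exists_idempotent hm hy
        refine h.exists_mul_eq hm he hW hs ?_
        rw [alph_append]
        refine Set.union_subset le_rfl fun b hb => ?_
        obtain rfl : b = a := by simpa [alph] using hb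
        exact ha
    · exact Or.inr ⟨u₀, b, u₁ ++ [a], by simp, h1, h2, h3⟩

theorem _root_.DAb.alph_reverse (w : List A) : alph w.reverse = alph w := by
  ext a; simp [alph]

theorem _root_.DAb.modCount_reverse (w : List A) : modCount m w.reverse = modCount m w := by
  funext a; simp [modCount, cnt]

/-- The last letter of a word that leaves the `ℒ`-class of `t`. -/
theorem exists_left_descent (h : LocallyAbelian g m) (hm : 1 ≤ m) (t : M) (v : List A) :
    (∀ z, alph z ⊆ alph v → modCount m z = modCount m v → wordVal g z * t = wordVal g v * t) ∨
    ∃ v₁ b v₀, v = v₁ ++ b :: v₀ ∧ b ∉ alph v₀ ∧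
      (∀ z, alph z ⊆ alph v₀ → modCount m z = modCount m v₀ →
        wordVal g z * t = wordVal g v₀ * t) ∧
      ¬ ∃ y, y * (g b * wordVal g v₀ * t) = t := by
  -- Reversing words and passing to the opposite monoid exchanges right and left multiplication,
  -- without changing alphabets or counts.
  have conv : ∀ w : List A, (∀ z, alph z ⊆ alph w → modCount m z = modCount m w →
      MulOpposite.op t * wordVal (fun a => MulOpposite.op (g a)) z =
        MulOpposite.op t * wordVal (fun a => MulOpposite.op (g a)) w) →
      (∀ z, alph z ⊆ alph w.reverse → modCount m z = modCount m w.reverse →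
        wordVal g z * t = wordVal g w.reverse * t) := by
    intro w hw z hz hc
    rw [alph_reverse] at hz
    rw [modCount_reverse] at hc
    have := hw z.reverse (by rwa [alph_reverse]) (by rwa [modCount_reverse])
    rw [wordVal_op, ← List.reverse_reverse w, wordVal_op, ← MulOpposite.op_mul,
      ← MulOpposite.op_mul] at this
    exact MulOpposite.op_injective this
  rcases h.op.exists_right_descent hm (MulOpposite.op t) v.reverse with h1 |
    ⟨u₀, a, u₁, hu, h1, h2, h3⟩
  · left
    simpa using conv _ h1
  · refine Or.inr ⟨u₁.reverse, a, u₀.reverse, ?_, by rwa [alph_reverse], conv _ h2, ?_⟩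
    · rw [← List.reverse_reverse v, hu]; simp
    · rintro ⟨y, hy⟩
      refine h3 ⟨MulOpposite.op y, ?_⟩
      rw [← List.reverse_reverse u₀, wordVal_op, ← MulOpposite.op_mul, ← MulOpposite.op_mul,
        ← MulOpposite.op_mul, hy]

end LocallyAbelian

/-! ### Marks given by rankers -/

/-- The position reached after `i` instructions of `X_{a₁} ⋯ X_{aₖ} X_{+∞}`. -/
noncomputable def xMark {A : Type*} (α : List A) (w : List A) (i : ℕ) : Pos :=
  xEval ((α.map XInstr.next ++ [XInstr.toEnd]).take i) w

/-- The position reached after `i` instructions of `Y_{b₁} ⋯ Y_{bₖ} Y_{-∞}`. -/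
noncomputable def yMark {A : Type*} (β : List A) (w : List A) (i : ℕ) : Pos :=
  yEval ((β.map YInstr.prev ++ [YInstr.toStart]).take i) w

section RankerMarks

variable {A : Type*} {α β w u v : List A}

theorem xMark_zero : xMark α w 0 = ⊥ := rfl

theorem yMark_zero : yMark β w 0 = ⊤ := rfl

theorem xMark_succ {i : ℕ} (hi : i < α.length) :
    xMark α w (i + 1) = (XInstr.next α[i]).eval w (xMark α w i) := by
  have : i < (α.map XInstr.next ++ [XInstr.toEnd]).length := by simp; omega
  rw [xMark, List.take_add_one, List.getElem?_eq_getElem this, Option.toList_some, xEval_snoc,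
    List.getElem_append_left (by simpa using hi), List.getElem_map, xMark]

theorem yMark_succ {i : ℕ} (hi : i < β.length) :
    yMark β w (i + 1) = (YInstr.prev β[i]).eval w (yMark β w i) := by
  have : i < (β.map YInstr.prev ++ [YInstr.toStart]).length := by simp; omega
  rw [yMark, List.take_add_one, List.getElem?_eq_getElem this, Option.toList_some, yEval_snoc,
    List.getElem_append_left (by simpa using hi), List.getElem_map, yMark]

theorem xMark_last : xMark α w (α.length + 1) = ⊤ := by
  rw [xMark, List.take_of_length_le (by simp), xEval_snoc]
  rfl

theorem yMark_last : yMark β w (β.length + 1) = ⊥ := by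
  rw [yMark, List.take_of_length_le (by simp), yEval_snoc]
  rfl

theorem xMark_valid (i : ℕ) : xMark α w i = ⊤ ∨ xMark α w i < at' w.length :=
  or_iff_not_imp_left.2 (xEval_lt _ w)

theorem yMark_valid (i : ℕ) : yMark β w i = ⊤ ∨ yMark β w i < at' w.length :=
  or_iff_not_imp_left.2 (yEval_lt _ w)

theorem posVal_lt_posVal {p q : Pos} (hp : p = ⊤ ∨ p < at' w.length)
    (hq : q = ⊤ ∨ q < at' w.length) : posVal w p < posVal w q ↔ p < q :=
  lt_iff_lt_of_cmp_eq_cmp (cmp_posVal hp hq)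

theorem marks_xMark (h : ∀ i ≤ α.length, xMark α w i ≠ ⊤) :
    Marks w α.length (fun i => α[i - 1]?) (fun i => posVal w (xMark α w i)) where
  zero := by simp [xMark_zero]
  last := by simp [xMark_last]
  lt_succ i hi := by
    rw [posVal_lt_posVal (xMark_valid i) (xMark_valid (i + 1))]
    rcases hi.lt_or_eq with hi' | rfl
    · rw [xMark_succ hi']
      rcases next_cases w (xMark α w i) α[i] with ⟨_, h2⟩ | ⟨_, h2, _, _, h3⟩
      · rw [h2]; exact (h i hi).lt_top
      · rwa [h3]
    · rw [xMark_last]; exact (h _ hi).lt_top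
  label i h1 hi := by
    obtain ⟨i, rfl⟩ := Nat.exists_eq_add_of_le' h1
    have hi' : i < α.length := hi
    rcases next_cases w (xMark α w i) α[i] with ⟨_, h2⟩ | ⟨j, _, h2, _, h3⟩
    · exact (h _ hi ((xMark_succ hi').trans h2)).elim
    · rw [xMark_succ hi', h3, posVal_at, Nat.add_sub_cancel, Nat.add_sub_cancel, h2,
        List.getElem?_eq_getElem hi']

/-- A `Y`-ranker visits its marks from right to left, so the index is reversed to list them in
increasing order. -/
theorem marks_yMark (h : ∀ i ≤ β.length, yMark β w i ≠ ⊥) :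
    Marks w β.length (fun i => β[β.length - i]?)
      (fun i => posVal w (yMark β w (β.length + 1 - i))) where
  zero := by simp [yMark_last]
  last := by simp [yMark_zero]
  lt_succ i hi := by
    obtain ⟨j, hj⟩ := Nat.exists_eq_add_of_le hi
    have e1 : β.length + 1 - i = j + 1 := by omega
    have e2 : β.length + 1 - (i + 1) = j := by omega
    rw [e1, e2, posVal_lt_posVal (yMark_valid _) (yMark_valid _)]
    rcases (show j ≤ β.length by omega).lt_or_eq with hj' | hj'
    · rw [yMark_succ hj']
      rcases prev_cases w (yMark β w j) β[j] with ⟨_, h2⟩ | ⟨_, h2, _, _, h3⟩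
      · rw [h2]; exact (h j hj'.le).bot_lt
      · rwa [h3]
    · rw [hj', yMark_last]; exact (h _ le_rfl).bot_lt
  label i h1 hi := by
    obtain ⟨j, hj⟩ := Nat.exists_eq_add_of_le hi
    have e1 : β.length + 1 - i = j + 1 := by omega
    have e2 : β.length - i = j := by omega
    have hj' : j < β.length := by omega
    rw [e1, e2]
    rcases prev_cases w (yMark β w j) β[j] with ⟨_, h2⟩ | ⟨k, _, h2, _, h3⟩
    · exact (h _ hj' ((yMark_succ hj').trans h2)).elim
    · rw [yMark_succ hj', h3, posVal_at, Nat.add_sub_cancel, h2, List.getElem?_eq_getElem hj']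

theorem valid_take {n : ℕ} (h : α.length + β.length ≤ n) (i j : ℕ) :
    Valid n ((α.map XInstr.next ++ [XInstr.toEnd]).take i)
      ((β.map YInstr.prev ++ [YInstr.toStart]).take j) :=
  ⟨α.map XInstr.next, β.map YInstr.prev, by simpa using h, List.take_prefix _ _,
    List.take_prefix _ _⟩

theorem block_zero_left (w : List A) (q : ℕ) : block w 0 q = w.take (q - 1) := by simp [block]

theorem block_last_right (w : List A) (p : ℕ) : block w p (w.length + 1) = w.drop p := by
  simp [block]

theorem Approx.marksAgree {m n : ℕ} (h : Approx m n u v) (hn : α.length + β.length ≤ n) :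
    MarksAgree m u v α.length β.length (fun i => posVal u (xMark α u i))
      (fun j => posVal u (yMark β u (β.length + 1 - j))) (fun i => posVal v (xMark α v i))
      (fun j => posVal v (yMark β v (β.length + 1 - j))) := by
  have hcmp : ∀ (w : List A) (i j : ℕ), cmp (posVal w (xMark α w i)) (posVal w (yMark β w j)) =
      cmp (xMark α w i) (yMark β w j) := fun w i j => cmp_posVal (xMark_valid _) (yMark_valid _)
  have hsplit : ∀ i j, posVal u (xMark α u i) ≤ posVal u (yMark β u j) →
      SplitCond m ((α.map XInstr.next ++ [XInstr.toEnd]).take i)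
      ((β.map YInstr.prev ++ [YInstr.toStart]).take j) u v := fun i j hle =>
    (approx_iff.1 h _ _ (valid_take hn i j)).2 ((le_iff_le_of_cmp_eq_cmp (hcmp u i j)).1 hle)
  refine ⟨fun i _ j _ => ?_, fun i _ j _ hle => ?_, fun i _ j _ hle a ha => ?_,
    fun i _ j _ hle a ha => ?_⟩
  · rw [hcmp, hcmp]
    exact (approx_iff.1 h _ _ (valid_take hn i (β.length + 1 - j))).1
  · rw [← between_eq_block, ← between_eq_block]
    exact (hsplit _ _ hle).1
  · rw [← between_eq_block] at ha
    have := ((hsplit _ _ hle).2 a ha).1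
    simp only [leftPart, between_eq_block, posVal_bot, block_zero_left] at this
    exact (ZMod.natCast_eq_natCast_iff _ _ _).2 this
  · rw [← between_eq_block] at ha
    have := ((hsplit _ _ hle).2 a ha).2
    simp only [rightPart, between_eq_block, posVal_top, block_last_right] at this
    exact (ZMod.natCast_eq_natCast_iff _ _ _).2 this

/-- The empty `Y`-ranker evaluates to `⊤`, so comparing with it detects whether an `X`-ranker has
run off the word. -/
theorem Approx.xMark_ne_top {m n : ℕ} (h : Approx m n u v) (hn : α.length ≤ n) {i : ℕ}
    (hi : xMark α u i ≠ ⊤) : xMark α v i ≠ ⊤ := by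
  have := (approx_iff.1 h _ _ (valid_take (β := []) (by simpa using hn) i 0)).1
  exact fun hc => hi ((eq_iff_eq_of_cmp_eq_cmp this).2 hc)

theorem Approx.yMark_ne_bot {m n : ℕ} (h : Approx m n u v) (hn : β.length ≤ n) {i : ℕ}
    (hi : yMark β u i ≠ ⊥) : yMark β v i ≠ ⊥ := by
  have := (approx_iff.1 h _ _ (valid_take (α := []) (by simpa using hn) 0 i)).1
  exact fun hc => hi ((eq_iff_eq_of_cmp_eq_cmp this).2 hc.symm).symm

end RankerMarks

/-! ### Factorizations along the `ℛ`-classes and the `ℒ`-classes -/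

section Factorization

variable {A M : Type*} [Monoid M] {g : A → M} {m : ℕ} {u v : List A}

/-- Behind the first `c` letters of `u`, the block from `c` to `d` may be replaced by any word with
the same counts modulo `m` and no new letters. -/
def XBlock (g : A → M) (m : ℕ) (u : List A) (c d : ℕ) : Prop :=
  ∀ z, alph z ⊆ alph (block u c d) → modCount m z = modCount m (block u c d) →
    wordVal g (u.take c) * wordVal g z = wordVal g (u.take c) * wordVal g (block u c d)

/-- In front of the suffix of `v` at `d`, the block from `c` to `d` may be replaced by any word
with the same counts modulo `m` and no new letters. -/
def YBlock (g : A → M) (m : ℕ) (v : List A) (c d : ℕ) : Prop :=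
  ∀ z, alph z ⊆ alph (block v c d) → modCount m z = modCount m (block v c d) →
    wordVal g z * wordVal g (v.drop (d - 1)) = wordVal g (block v c d) * wordVal g (v.drop (d - 1))

/-- All blocks cut out by the `X`-ranker of `α`, started at `P`, can be replaced. -/
def XGood (g : A → M) (m : ℕ) (u : List A) : Pos → List A → Prop
  | P, [] => XBlock g m u (posVal u P) (u.length + 1)
  | P, a :: α => (XInstr.next a).eval u P ≠ ⊤ ∧
      XBlock g m u (posVal u P) (posVal u ((XInstr.next a).eval u P)) ∧
      XGood g m u ((XInstr.next a).eval u P) α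

/-- All blocks cut out by the `Y`-ranker of `β`, started at `Q`, can be replaced. -/
def YGood (g : A → M) (m : ℕ) (v : List A) : Pos → List A → Prop
  | Q, [] => YBlock g m v 0 (posVal v Q)
  | Q, b :: β => (YInstr.prev b).eval v Q ≠ ⊥ ∧
      YBlock g m v (posVal v ((YInstr.prev b).eval v Q)) (posVal v Q) ∧
      YGood g m v ((YInstr.prev b).eval v Q) β

theorem XGood.foldl {α : List A} {P : Pos} (h : XGood g m u P α) (hP : P ≠ ⊤) {i : ℕ}
    (hi : i ≤ α.length) :
    ((α.map XInstr.next ++ [XInstr.toEnd]).take i).foldl (fun p (X : XInstr A) => X.eval u p) P ≠ ⊤ ∧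
    XBlock g m u
      (posVal u (((α.map XInstr.next ++ [XInstr.toEnd]).take i).foldl (fun p (X : XInstr A) => X.eval u p) P))
      (posVal u (((α.map XInstr.next ++ [XInstr.toEnd]).take (i + 1)).foldl
        (fun p (X : XInstr A) => X.eval u p) P)) := by
  induction α generalizing P i with
  | nil =>
    obtain rfl : i = 0 := by simpa using hi
    exact ⟨hP, h⟩
  | cons a α ih =>
    rcases i with _ | i
    · refine ⟨hP, ?_⟩
      simpa using h.2.1
    · exact ih h.2.2 h.1 (by simpa using hi)

theorem YGood.foldl {β : List A} {Q : Pos} (h : YGood g m v Q β) (hQ : Q ≠ ⊥) {i : ℕ}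
    (hi : i ≤ β.length) :
    ((β.map YInstr.prev ++ [YInstr.toStart]).take i).foldl (fun p (Y : YInstr A) => Y.eval v p) Q ≠ ⊥ ∧
    YBlock g m v
      (posVal v (((β.map YInstr.prev ++ [YInstr.toStart]).take (i + 1)).foldl
        (fun p (Y : YInstr A) => Y.eval v p) Q))
      (posVal v (((β.map YInstr.prev ++ [YInstr.toStart]).take i).foldl
        (fun p (Y : YInstr A) => Y.eval v p) Q)) := by
  induction β generalizing Q i with
  | nil =>
    obtain rfl : i = 0 := by simpa using hi
    exact ⟨hQ, h⟩
  | cons b β ih =>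
    rcases i with _ | i
    · refine ⟨hQ, ?_⟩
      simpa using h.2.1
    · exact ih h.2.2 h.1 (by simpa using hi)

theorem lt_at_iff {w : List A} {P : Pos} (hP : P ≠ ⊤) {i : ℕ} : P < at' i ↔ posVal w P ≤ i := by
  rcases pos_cases P with rfl | rfl | ⟨j, rfl⟩
  · simp
  · exact (hP rfl).elim
  · simp only [at_lt_at, posVal_at]; omega

theorem at_lt_iff {w : List A} {Q : Pos} {i : ℕ} (hi : i < w.length) :
    at' i < Q ↔ i + 1 < posVal w Q := by
  rcases pos_cases Q with rfl | rfl | ⟨j, rfl⟩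
  · simp
  · simpa using hi
  · simp

/-- `P` is the last position of the prefix `x` already treated. The descent letter does not occur in
the block before it, so the instruction `next a` lands exactly there. The bound `n` is on the size
of the right ideal generated by the prefix value, which shrinks strictly at each descent. -/
theorem LocallyAbelian.exists_xGood [Finite M] (h : LocallyAbelian g m) (hm : 1 ≤ m) (n : ℕ)
    (x y : List A) (P : Pos) (hu : u = x ++ y) (hP : P ≠ ⊤) (hx : posVal u P = x.length)
    (hn : Set.ncard {r : M | ∃ z, r = wordVal g x * z} ≤ n) :
    ∃ α, α.length ≤ n ∧ XGood g m u P α := by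
  induction n generalizing x y P with
  | zero =>
    rw [Nat.le_zero, Set.ncard_eq_zero] at hn
    exact absurd hn (Set.Nonempty.ne_empty ⟨wordVal g x, 1, by simp⟩)
  | succ n ih =>
    rcases h.exists_right_descent hm (wordVal g x) y with h1 | ⟨y0, a, y1, rfl, h1, h2, h3⟩
    · refine ⟨[], by simp, ?_⟩
      rw [XGood, hx, XBlock, block_last_right, hu, List.drop_left, List.take_left]
      exact h1
    · have hlen : u.length = x.length + (y0.length + (y1.length + 1)) := by simp [hu]
      have hget : u[x.length + y0.length]? = some a := by
        rw [hu, List.getElem?_append_right (by omega), Nat.add_sub_cancel_left,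
          List.getElem?_append_right le_rfl, Nat.sub_self, List.getElem?_cons_zero]
      have hev : (XInstr.next a).eval u P = at' (x.length + y0.length) := by
        refine next_at ((lt_at_iff (w := u) hP).2 (by omega)) hget fun j hj1 hj2 => ?_
        have hj1 := (lt_at_iff (w := u) hP).1 hj1
        by_contra hc
        rw [hu, List.getElem?_append_right (by omega), List.getElem?_append_left (by omega)] at hj2
        exact h1 (List.mem_iff_getElem?.2 ⟨_, hj2⟩)
      have hblock : block u x.length (x.length + y0.length + 1) = y0 := by
        rw [block, Nat.add_sub_cancel, hu, ← List.append_assoc,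
          List.take_left' (by simp), List.drop_left]
      obtain ⟨α, hα, hg⟩ := ih (x ++ y0 ++ [a]) y1 (at' (x.length + y0.length)) (by simp [hu])
        (by simp) (by simp; omega) (by
          -- The old prefix value lies in its own right ideal but not in the new one, as it cannot
          -- be recovered after the descent.
          refine Nat.le_of_lt_succ (lt_of_lt_of_le (Set.ncard_lt_ncard ?_) hn)
          refine (Set.ssubset_iff_of_subset ?_).2 ⟨wordVal g x, ⟨1, by simp⟩, ?_⟩
          · rintro _ ⟨z, rfl⟩
            exact ⟨wordVal g (y0 ++ [a]) * z, by simp [mul_assoc]⟩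
          · rintro ⟨z, hz⟩
            exact h3 ⟨z, by simpa [mul_assoc] using hz.symm⟩)
      refine ⟨a :: α, by simpa using hα, ?_, ?_, ?_⟩
      · simp [hev]
      · rw [hev, hx, posVal_at, XBlock, hblock, hu, List.take_left]
        exact h2
      · rw [hev]; exact hg

/-- Dual to `exists_xGood`: here `y` is the suffix already treated, and the left ideals generated by
the suffix values shrink. -/
theorem LocallyAbelian.exists_yGood [Finite M] (h : LocallyAbelian g m) (hm : 1 ≤ m) (n : ℕ)
    (x y : List A) (Q : Pos) (hv : v = x ++ y) (hx : posVal v Q = x.length + 1)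
    (hn : Set.ncard {r : M | ∃ z, r = z * wordVal g y} ≤ n) :
    ∃ β, β.length ≤ n ∧ YGood g m v Q β := by
  induction n generalizing x y Q with
  | zero =>
    rw [Nat.le_zero, Set.ncard_eq_zero] at hn
    exact absurd hn (Set.Nonempty.ne_empty ⟨wordVal g y, 1, by simp⟩)
  | succ n ih =>
    rcases h.exists_left_descent hm (wordVal g y) x with h1 | ⟨x1, b, x0, rfl, h1, h2, h3⟩
    · refine ⟨[], by simp, ?_⟩
      rw [YGood, hx, YBlock, block_zero_left, Nat.add_sub_cancel, hv, List.drop_left,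
        List.take_left]
      exact h1
    · have hlen : v.length = x1.length + (x0.length + 1) + y.length := by
        simp [hv]; omega
      rw [List.length_append, List.length_cons] at hx
      have hget : v[x1.length]? = some b := by
        rw [hv, List.append_assoc, List.getElem?_append_right le_rfl, Nat.sub_self,
          List.cons_append, List.getElem?_cons_zero]
      have hev : (YInstr.prev b).eval v Q = at' x1.length := by
        refine prev_at ((at_lt_iff (w := v) (by omega)).2 (by omega)) hget fun j hj1 hj2 => ?_
        have hjl := (List.getElem?_eq_some_iff.1 hj2).1
        have hj1 := (at_lt_iff (w := v) hjl).1 hj1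
        by_contra hc
        obtain ⟨i, rfl⟩ : ∃ i, j = x1.length + 1 + i := ⟨j - x1.length - 1, by omega⟩
        rw [hv, List.append_assoc, List.getElem?_append_right (by omega), List.cons_append,
          show x1.length + 1 + i - x1.length = i + 1 by omega, List.getElem?_cons_succ,
          List.getElem?_append_left (by omega)] at hj2
        exact h1 (List.mem_iff_getElem?.2 ⟨_, hj2⟩)
      have hblock : block v (x1.length + 1) (x1.length + (x0.length + 1) + 1) = x0 := by
        rw [block, Nat.add_sub_cancel, hv, List.take_left' (by simp), List.append_cons,
          List.drop_left' (by simp)]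
      obtain ⟨β, hβ, hg⟩ := ih x1 (b :: x0 ++ y) (at' x1.length) (by simp [hv]) (by simp) (by
          refine Nat.le_of_lt_succ (lt_of_lt_of_le (Set.ncard_lt_ncard ?_) hn)
          refine (Set.ssubset_iff_of_subset ?_).2 ⟨wordVal g y, ⟨1, by simp⟩, ?_⟩
          · rintro _ ⟨z, rfl⟩
            exact ⟨z * wordVal g (b :: x0), by simp [mul_assoc]⟩
          · rintro ⟨z, hz⟩
            exact h3 ⟨z, by simpa [mul_assoc] using hz.symm⟩)
      refine ⟨b :: β, by simpa using hβ, ?_, ?_, ?_⟩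
      · simp [hev]
      · rw [hev, hx, posVal_at, YBlock, hblock, Nat.add_sub_cancel, hv,
          List.drop_left' (by simp)]
        exact h2
      · rw [hev]; exact hg

theorem take_eq_take_append {w : List A} {p : ℕ} {a : A} (h : 1 ≤ p) (ha : w[p - 1]? = some a) :
    w.take p = w.take (p - 1) ++ [a] := by
  obtain ⟨p, rfl⟩ := Nat.exists_eq_add_of_le' h
  rw [Nat.add_sub_cancel] at ha ⊢
  rw [List.take_add_one, ha, Option.toList_some]

theorem drop_eq_cons_drop {w : List A} {p : ℕ} {a : A} (h : 1 ≤ p) (ha : w[p - 1]? = some a) :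
    w.drop (p - 1) = a :: w.drop p := by
  obtain ⟨p, rfl⟩ := Nat.exists_eq_add_of_le' h
  rw [Nat.add_sub_cancel] at ha ⊢
  obtain ⟨hp, rfl⟩ := List.getElem?_eq_some_iff.1 ha
  exact List.drop_eq_getElem_cons hp

theorem drop_eq_block_append (w : List A) {p q : ℕ} (h : p < q) (hq : q ≤ w.length + 1) :
    w.drop p = block w p q ++ w.drop (q - 1) := by
  conv_lhs => rw [← List.take_append_drop (q - 1) w]
  rw [block, List.drop_append_of_le_length]
  rw [List.length_take]
  omega

theorem modCount_block {w : List A} {p q : ℕ} (h : p < q) {z : List A}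
    (hz : modCount m (w.take p) + modCount m z = modCount m (w.take (q - 1))) :
    modCount m z = modCount m (block w p q) := by
  rw [take_eq_append_block w h, modCount_append] at hz
  exact add_left_cancel hz

/-- `XBlock` permits a replacement only behind the original prefix of `u`. The blocks are therefore
restored from left to right, and the prefix value is always that of `u` when a block is treated. -/
theorem Follows.wordVal_of_xBlock {k : ℕ} {c : ℕ → Option A} {p : ℕ → ℕ} (hp : Marks u k c p)
    (hb : ∀ i ≤ k, XBlock g m u (p i) (p (i + 1))) {s i : ℕ} (hs : i + s = k) {Z : List A}
    (h : Follows m u p s i (modCount m (u.take (p i))) Z) :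
    wordVal g (u.take (p i)) * wordVal g Z = wordVal g u := by
  have hlt := hp.lt_succ i (by omega)
  have key : ∀ z, alph z ⊆ alph (block u (p i) (p (i + 1))) →
      modCount m (u.take (p i)) + modCount m z = modCount m (u.take (p (i + 1) - 1)) →
      wordVal g (u.take (p i)) * wordVal g z = wordVal g (u.take (p (i + 1) - 1)) := by
    intro z h1 h2
    rw [hb i (by omega) z h1 (modCount_block hlt h2), ← wordVal_append,
      ← take_eq_append_block u hlt]
  induction s generalizing i Z with
  | zero =>
    rw [key Z h.1 h.2]
    obtain rfl : i = k := hs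
    rw [hp.last, Nat.add_sub_cancel, List.take_length]
  | succ s ih =>
    obtain ⟨z, a, Z', rfl, h1, h2, h3, h4⟩ := h
    have hlt' := hp.lt_succ (i + 1) (by omega)
    have := ih (by omega) h4 hlt' (by
      intro z h1 h2
      rw [hb (i + 1) (by omega) z h1 (modCount_block hlt' h2), ← wordVal_append,
        ← take_eq_append_block u hlt'])
    rw [take_eq_take_append (by omega) h1] at this
    rw [← this, wordVal_append, wordVal_append, ← mul_assoc, key z h2 h3]
    simp [mul_assoc]

/-- Here a replacement is permitted in front of the original suffix of `v`, so the induction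
restores the blocks from the right. -/
theorem Follows.wordVal_of_yBlock {l : ℕ} {d : ℕ → Option A} {q : ℕ → ℕ} (hq : Marks v l d q)
    (hb : ∀ j ≤ l, YBlock g m v (q j) (q (j + 1))) {t j : ℕ} (ht : j + t = l) {Z : List A}
    (h : Follows m v q t j (modCount m (v.take (q j))) Z) :
    wordVal g Z = wordVal g (v.drop (q j)) := by
  induction t generalizing j Z with
  | zero =>
    have hlt := hq.lt_succ j (by omega)
    have := hb j (by omega) Z h.1 (modCount_block hlt h.2)
    obtain rfl : j = l := ht
    rw [hq.last, Nat.add_sub_cancel, List.drop_length, block_last_right] at this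
    simpa using this
  | succ t ih =>
    obtain ⟨z, a, Z', rfl, h1, h2, h3, h4⟩ := h
    have hlt := hq.lt_succ j (by omega)
    have hle := hq.le_of_le (show j + 1 ≤ l + 1 by omega) le_rfl
    rw [hq.last] at hle
    have := hb j (by omega) z h2 (modCount_block hlt h3)
    rw [drop_eq_block_append v hlt hle, wordVal_append, wordVal_append, ← this,
      drop_eq_cons_drop (by omega) h1, wordVal_cons, wordVal_cons, ih (by omega) h4]

/-- Words that are equivalent for long rankers have the same value. -/
theorem LocallyAbelian.wordVal_eq [Finite M] (h : LocallyAbelian g m) (hm : 1 ≤ m)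
    (huv : Approx m (2 * Nat.card M) u v) : wordVal g u = wordVal g v := by
  have : NeZero m := ⟨by omega⟩
  have hcard : ∀ s : Set M, s.ncard ≤ Nat.card M := fun s => Set.ncard_le_card s
  -- The `X`-ranker comes from `u` and the `Y`-ranker from `v`. Each has length at most `Nat.card
  -- M`, which accounts for the factor 2.
  obtain ⟨α, hα, hg⟩ := h.exists_xGood hm (Nat.card M) (u := u) [] u ⊥ rfl bot_ne_top rfl
    (hcard _)
  obtain ⟨β, hβ, hg'⟩ := h.exists_yGood hm (Nat.card M) (v := v) v [] ⊤ (by simp) rfl (hcard _)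
  have hx : ∀ i ≤ α.length, xMark α u i ≠ ⊤ ∧
      XBlock g m u (posVal u (xMark α u i)) (posVal u (xMark α u (i + 1))) :=
    fun i hi => hg.foldl bot_ne_top hi
  have hy : ∀ i ≤ β.length, yMark β v i ≠ ⊥ ∧
      YBlock g m v (posVal v (yMark β v (i + 1))) (posVal v (yMark β v i)) :=
    fun i hi => hg'.foldl top_ne_bot hi
  have mx := marks_xMark fun i hi => (hx i hi).1
  have my := marks_yMark fun i hi => (hy i hi).1
  have mx' := marks_xMark (w := v) fun i hi => huv.xMark_ne_top (by omega) (hx i hi).1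
  have my' := marks_yMark (w := u) fun i hi => huv.symm.yMark_ne_bot (by omega) (hy i hi).1
  -- `Z` has the value of `u` by the `X`-blocks and the value of `v` by the `Y`-blocks.
  obtain ⟨Z, hZ1, hZ2⟩ := (huv.marksAgree (by omega)).exists_follows mx my' mx' my
  have e1 := Follows.wordVal_of_xBlock (g := g) mx (fun i hi => (hx i hi).2) (Nat.zero_add _)
    (Z := Z) (by simpa [xMark_zero] using hZ1)
  have e2 := Follows.wordVal_of_yBlock (g := g) my (fun j hj => by
      have := (hy (β.length - j) (by omega)).2
      rw [show β.length - j + 1 = β.length + 1 - j by omega] at this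
      rw [show β.length + 1 - (j + 1) = β.length - j by omega]
      exact this) (Nat.zero_add _)
    (Z := Z) (by simpa [yMark_last] using hZ2)
  simp only [xMark_zero, posVal_bot, List.take_zero, wordVal_nil, one_mul] at e1
  simp only [Nat.sub_zero, yMark_last, posVal_bot, List.drop_zero] at e2
  rw [← e1, e2]

end Factorization

/-! ### Semigroups in `DAb` -/

section Forward

variable {S : Type*} [Semigroup S]

/-- S is an ideal of S¹, so products in S¹ with a factor from S can be pulled back to S. -/
theorem exists_coe_eq_mul (x y : WithOne S) (s : S) : ∃ t : S, (t : WithOne S) = x * s * y := by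
  rcases eq_or_ne x 1 with rfl | hx <;> rcases eq_or_ne y 1 with rfl | hy
  · exact ⟨s, by simp⟩
  · lift y to S using hy; exact ⟨s * y, by simp⟩
  · lift x to S using hx; exact ⟨x * s, by simp⟩
  · lift x to S using hx; lift y to S using hy; exact ⟨x * s * y, by simp⟩

theorem isIdempotentElem_coe {e : S} :
    IsIdempotentElem (e : WithOne S) ↔ IsIdempotentElem e := by
  rw [IsIdempotentElem, IsIdempotentElem, ← WithOne.coe_mul, WithOne.coe_inj]

variable {e : S}

/-- The class is a group, and a group has only one idempotent. -/
theorem IsDAbS.eq_of_greenD (hS : IsDAbS S) (he : IsIdempotentElem e) {f : S}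
    (hf : IsIdempotentElem f) (h : GreenD e f) : f = e := by
  obtain ⟨-, -, o, -, ho, ho'⟩ := hS.2 e ⟨e, Relation.ReflTransGen.refl, he⟩
  have key : ∀ f, IsIdempotentElem f → GreenD e f → f = o := by
    intro f hf h
    obtain ⟨t, -, ht⟩ := ho' f h
    rw [← ho f h, ← ht, mul_assoc, hf]
  rw [key f hf h, key e he Relation.ReflTransGen.refl]

theorem IsDAbS.mul_left_eq (hS : IsDAbS S) (he : IsIdempotentElem e) {s : S} (h : GreenD e s) :
    e * s = s := by
  obtain ⟨-, -, o, ho, ho', ho''⟩ := hS.2 e ⟨e, Relation.ReflTransGen.refl, he⟩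
  rw [← hS.eq_of_greenD he (ho' o ho) ho]
  exact ho' s h

theorem IsDAbS.mul_comm_of_greenD (hS : IsDAbS S) (he : IsIdempotentElem e) {s t : S}
    (h : GreenD e s) (h' : GreenD e t) : s * t = t * s :=
  (hS.2 e ⟨e, Relation.ReflTransGen.refl, he⟩).2.1 s h t h'

theorem IsDAbS.mul_mem (hS : IsDAbS S) (he : IsIdempotentElem e) {s t : S}
    (h : GreenD e s) (h' : GreenD e t) : GreenD e (s * t) :=
  (hS.2 e ⟨e, Relation.ReflTransGen.refl, he⟩).1 s h t h'

/-- A factor `a` of an idempotent `e` commutes with `e`, and `e * a` lies in the group of `e`. -/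
theorem IsDAbS.mul_comm_of_factor (hS : IsDAbS S) (he : IsIdempotentElem e) {x y : WithOne S}
    {a : S} (hx : (e : WithOne S) = x * a * y) : GreenD e (e * a) ∧ e * a = a * e := by
  have he' : (e : WithOne S) * e = e := isIdempotentElem_coe.2 he
  have hee : x * (a * (y * e)) = (e : WithOne S) := by
    simp only [← mul_assoc]; rw [← hx, he']
  have hee' : (e : WithOne S) * (x * (a * y)) = e := by
    simp only [← mul_assoc] at hx ⊢; rw [mul_assoc (e : WithOne S), mul_assoc (e : WithOne S), ← hx,
      he']
  -- The conjugates `f = a y e x` and `f' = y e x a` of `e = x a y` are idempotents in the 𝒟-class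
  -- of `e`, linked to it through `r = e x` and `r' = y e`. Hence both equal `e`.
  obtain ⟨f, hf⟩ := exists_coe_eq_mul 1 (y * (e : WithOne S) * x) a
  obtain ⟨f', hf'⟩ := exists_coe_eq_mul (y * (e : WithOne S) * x) 1 a
  obtain ⟨r, hr⟩ := exists_coe_eq_mul 1 x e
  obtain ⟨r', hr'⟩ := exists_coe_eq_mul y 1 e
  simp only [one_mul, mul_one, mul_assoc] at hf hf' hr hr' hee'
  have e1 : ∀ z : WithOne S, x * (a * (y * (e * z))) = e * z := fun z => by
    simpa only [mul_assoc] using congrArg (· * z) hee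
  have e2 : ∀ z : WithOne S, (e : WithOne S) * (x * (a * (y * z))) = e * z := fun z => by
    simpa only [mul_assoc] using congrArg (· * z) hee'
  have e3 : ∀ z : WithOne S, (e : WithOne S) * (e * z) = e * z := fun z => by
    rw [← mul_assoc, he']
  have f1 : f = e := by
    refine hS.eq_of_greenD he ?_ ?_
    · rw [← isIdempotentElem_coe, IsIdempotentElem, hf]
      simp only [mul_assoc, e1, e3]
    · refine Relation.ReflTransGen.head (b := r) (Or.inr ?_) (Relation.ReflTransGen.single (Or.inl ?_))
      · exact ⟨x, a * (y * e), hr.symm, by rw [hr]; simp only [mul_assoc]; rw [hee, he']⟩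
      · exact ⟨a * y, x, by rw [hr, hf]; simp only [mul_assoc],
          by rw [hr, hf]; simp only [e1]⟩
  have f2 : f' = e := by
    refine hS.eq_of_greenD he ?_ ?_
    · rw [← isIdempotentElem_coe, IsIdempotentElem, hf']
      simp only [mul_assoc, e1, e3]
    · refine Relation.ReflTransGen.head (b := r') (Or.inl ?_) (Relation.ReflTransGen.single (Or.inr ?_))
      · exact ⟨y, e * (x * a), hr'.symm, by rw [hr']; simp only [mul_assoc]; rw [e2, he']⟩
      · exact ⟨x * a, y, by rw [hr', hf']; simp only [mul_assoc],
          by rw [hr', hf']; simp only [mul_assoc]; rw [hee']⟩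
  rw [f1] at hf
  rw [f2] at hf'
  -- From `e = a (y e x) = (y e x) a`, multiplication of `e` by `a` on either side can be undone, so
  -- `e * a` and `a * e` both lie in the group of `e`.
  have d1 : GreenD e (e * a) := by
    refine Relation.ReflTransGen.single (Or.inr ⟨a, y * (e * x), by simp, ?_⟩)
    rw [WithOne.coe_mul, mul_assoc, ← hf, he']
  have d2 : GreenD e (a * e) := by
    refine Relation.ReflTransGen.single (Or.inl ⟨a, y * (e * x), by simp, ?_⟩)
    rw [WithOne.coe_mul]
    simp only [mul_assoc]
    conv_lhs => rw [← he', hf']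
    simp only [mul_assoc]
    rw [← hf']
  refine ⟨d1, ?_⟩
  -- As `e` is the identity of that group, `e a` and `a e` both equal `e a e`.
  have c1 := hS.mul_left_eq he d2
  have c2 := hS.mul_comm_of_greenD he d1 Relation.ReflTransGen.refl
  rw [← c1, ← mul_assoc, c2, ← mul_assoc, he]

/-- The pigeonhole principle is applied to the functions `t ↦ t ^ k` on all of `M`, which gives one
index and one period for all elements at once. -/
theorem exists_pow_isIdempotentElem (M : Type*) [Monoid M] [Finite M] :
    ∃ m : ℕ, 1 ≤ m ∧ ∀ t : M, IsIdempotentElem (t ^ m) := by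
  obtain ⟨i, j, hij, h⟩ := Finite.exists_ne_map_eq_of_infinite (fun (k : ℕ) (t : M) => t ^ k)
  wlog hlt : i < j generalizing i j
  · exact this j i hij.symm h.symm (by omega)
  obtain ⟨d, rfl⟩ := Nat.exists_eq_add_of_lt hlt
  have step : ∀ (t : M) (a : ℕ), i ≤ a → ∀ k, t ^ (a + (d + 1) * k) = t ^ a := by
    intro t a ha k
    induction k with
    | zero => simp
    | succ k ih =>
      obtain ⟨b, rfl⟩ := Nat.exists_eq_add_of_le ha
      have : t ^ i = t ^ (i + d + 1) := congrFun h t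
      rw [show i + b + (d + 1) * (k + 1) = (i + d + 1) + (b + (d + 1) * k) by ring, pow_add, ← this,
        ← pow_add, ← add_assoc, ih]
  -- This exponent is a multiple of the period `d + 1` and at least the index `i`, so doubling it
  -- does not change the power.
  refine ⟨(d + 1) * (i + 1), Nat.mul_pos (by omega) (by omega), fun t => ?_⟩
  rw [IsIdempotentElem, ← pow_add]
  exact step t _ (by nlinarith) _

theorem IsDAbS.locallyAbelian {A : Type*} (hS : IsDAbS S) (ι : A → S) {m : ℕ} (hm : 1 ≤ m)
    (h : ∀ t : WithOne S, IsIdempotentElem (t ^ m)) :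
    LocallyAbelian (fun a => (ι a : WithOne S)) m where
  idem := h
  comm e x y a he hx := by
    -- Being a multiple of a letter, `e` lies in S and is not the adjoined identity, so the
    -- hypothesis on 𝒟-classes applies to it.
    obtain ⟨e, rfl⟩ : ∃ e' : S, (e' : WithOne S) = e := by rw [hx]; exact exists_coe_eq_mul x y _
    have := (hS.mul_comm_of_factor (isIdempotentElem_coe.1 he) hx).2
    exact_mod_cast congrArg (WithOne.coe : S → WithOne S) this
  comm₂ e x y x' y' a b he hx hx' := by
    obtain ⟨e, rfl⟩ : ∃ e' : S, (e' : WithOne S) = e := by rw [hx]; exact exists_coe_eq_mul x y _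
    rw [isIdempotentElem_coe] at he
    obtain ⟨d1, c1⟩ := hS.mul_comm_of_factor he hx
    obtain ⟨d2, c2⟩ := hS.mul_comm_of_factor he hx'
    have c := hS.mul_comm_of_greenD he d1 d2
    -- `e * g a` and `e * g b` commute in the group of `e`; the idempotent in the middle of their
    -- product is then absorbed.
    have key : ∀ s t : S, e * s = s * e → e * s * (e * t) = e * (s * t) := by
      intro s t hs
      rw [mul_assoc, ← mul_assoc s, ← hs, mul_assoc e s, ← mul_assoc e e, he]
    rw [key _ _ c1, key _ _ c2] at c
    exact_mod_cast congrArg (WithOne.coe : S → WithOne S) c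
  pow e x y a he hx := by
    obtain ⟨e, rfl⟩ : ∃ e' : S, (e' : WithOne S) = e := by rw [hx]; exact exists_coe_eq_mul x y _
    have he' := isIdempotentElem_coe.1 he
    obtain ⟨d, c⟩ := hS.mul_comm_of_factor he' hx
    have hpow : ∀ k : ℕ, 1 ≤ k → ∃ t : S, GreenD e t ∧
        (t : WithOne S) = (e * ι a : WithOne S) ^ k := by
      intro k hk
      induction k, hk using Nat.le_induction with
      | base => exact ⟨e * ι a, d, by simp⟩
      | succ k _ ih =>
        obtain ⟨t, ht, ht'⟩ := ih
        exact ⟨t * (e * ι a), hS.mul_mem he' ht d, by rw [pow_succ, ← ht']; simp⟩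
    -- The power `(e * a) ^ m` is an idempotent in the group of `e`, hence equals `e`; as the two
    -- factors commute, it is also `e * a ^ m`.
    obtain ⟨t, ht, ht'⟩ := hpow m hm
    have hc : Commute (e : WithOne S) (ι a) := by
      have := congrArg (WithOne.coe : S → WithOne S) c
      rwa [WithOne.coe_mul, WithOne.coe_mul] at this
    have hte : t = e :=
      hS.eq_of_greenD he' (isIdempotentElem_coe.1 (by rw [ht']; exact h _)) ht
    obtain ⟨k, rfl⟩ := Nat.exists_eq_add_of_le' hm
    rw [hc.mul_pow, he.pow_succ_eq, hte] at ht'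
    exact ht'.symm

theorem coe_lift_eq_wordVal {A : Type*} (ι : A → S) (w : FreeSemigroup A) :
    (FreeSemigroup.lift ι w : WithOne S) = wordVal (fun a => (ι a : WithOne S)) (word w) := by
  induction w using FreeSemigroup.recOnMul with
  | ih1 a => rw [FreeSemigroup.lift_of]; simp [word, FreeSemigroup.of]
  | ih2 a w h1 h2 => rw [map_mul, WithOne.coe_mul, h1, h2, word_mul, wordVal_append]

theorem IsDAbS.exists_hom {A : Type*} (hS : IsDAbS S) (ι : A → S)
    (hgen : Subsemigroup.closure (Set.range ι) = ⊤) :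
    ∃ m n : ℕ, 1 ≤ m ∧ 1 ≤ n ∧
      ∃ f : (approxCon A m n).Quotient →ₙ* S, Function.Surjective f := by
  have := hS.1
  have : Finite (WithOne S) := inferInstanceAs (Finite (Option S))
  obtain ⟨m, hm, hidem⟩ := exists_pow_isIdempotentElem (WithOne S)
  have hl := hS.locallyAbelian ι hm hidem
  refine ⟨m, 2 * Nat.card (WithOne S), hm, by have := Nat.card_pos (α := WithOne S); omega,
    ⟨fun q => Con.liftOn q (FreeSemigroup.lift ι) ?_, ?_⟩, ?_⟩
  · intro u v huv
    have := hl.wordVal_eq hm huv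
    rw [← coe_lift_eq_wordVal, ← coe_lift_eq_wordVal] at this
    exact WithOne.coe_inj.1 this
  · intro p q
    induction p, q using Con.induction_on₂ with
    | _ p q => exact map_mul (FreeSemigroup.lift ι) p q
  · intro s
    have hs : s ∈ (FreeSemigroup.lift ι).srange := by
      have : Subsemigroup.closure (Set.range ι) ≤ (FreeSemigroup.lift ι).srange := by
        rw [Subsemigroup.closure_le]
        rintro _ ⟨a, rfl⟩
        exact ⟨FreeSemigroup.of a, by simp⟩
      exact this (by rw [hgen]; trivial)
    obtain ⟨w, hw⟩ := hs
    exact ⟨(w : (approxCon A m _).Quotient), hw⟩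

end Forward

/-! ### Words in which every ranker stays near the ends -/

section Rich

variable {A : Type*} {w : List A}

/-- Each instruction finds its letter at the latest in the next copy of `w`, so a ranker uses up at
most one copy per instruction. In the induction the last copy is moved into `r`. -/
theorem xEval_lt_of_length_le (h : List A) (r : List A) {ρ : XRanker A}
    (hρ : ∀ X ∈ ρ, ∃ a ∈ w, X = XInstr.next a) {i : ℕ} (hi : ρ.length ≤ i) :
    xEval ρ (h ++ (List.replicate i w).flatten ++ r) < at' (h.length + i * w.length) := by
  induction ρ using List.reverseRecOn generalizing i r with
  | nil => simp
  | append_singleton ρ X ih =>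
    obtain ⟨i, rfl⟩ : ∃ i', i = i' + 1 := ⟨i - 1, by simp at hi; omega⟩
    obtain ⟨a, ha, rfl⟩ := hρ X (by simp)
    have e : h ++ (List.replicate (i + 1) w).flatten ++ r =
        h ++ (List.replicate i w).flatten ++ (w ++ r) := by
      rw [List.replicate_succ']; simp
    rw [xEval_snoc, e]
    have hP := ih (w ++ r) (fun X hX => hρ X (List.mem_append_left _ hX))
      (show ρ.length ≤ i by simpa using hi)
    obtain ⟨j, hj, hja⟩ := List.mem_iff_getElem.1 ha
    have hlen : (h ++ (List.replicate i w).flatten).length = h.length + i * w.length := by simp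
    have : XInstr.eval (h ++ (List.replicate i w).flatten ++ (w ++ r))
        (xEval ρ (h ++ (List.replicate i w).flatten ++ (w ++ r))) (XInstr.next a) ≤
        at' (h.length + i * w.length + j) := by
      refine sInf_le ⟨hP.trans_le (by simp), _, rfl, ?_⟩
      rw [List.getElem?_append_right (by rw [hlen]; omega), hlen, Nat.add_sub_cancel_left,
        List.getElem?_append_left hj, List.getElem?_eq_getElem hj, hja]
    refine this.trans_lt (at_lt_at.2 ?_)
    rw [Nat.add_one_mul]
    omega

theorem le_yEval_of_length_le (h : List A) (r : List A) {l : YRanker A}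
    (hl : ∀ Y ∈ l, ∃ a ∈ w, Y = YInstr.prev a) {i : ℕ} (hi : l.length ≤ i) :
    at' r.length ≤ yEval l (r ++ (List.replicate i w).flatten ++ h) := by
  induction l using List.reverseRecOn generalizing i r with
  | nil => simp
  | append_singleton l Y ih =>
    obtain ⟨i, rfl⟩ : ∃ i', i = i' + 1 := ⟨i - 1, by simp at hi; omega⟩
    obtain ⟨a, ha, rfl⟩ := hl Y (by simp)
    have e : r ++ (List.replicate (i + 1) w).flatten ++ h =
        r ++ w ++ (List.replicate i w).flatten ++ h := by
      rw [List.replicate_succ]; simp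
    rw [yEval_snoc, e]
    have hP := ih (r ++ w) (fun X hX => hl X (List.mem_append_left _ hX))
      (show l.length ≤ i by simpa using hi)
    obtain ⟨j, hj, hja⟩ := List.mem_iff_getElem.1 ha
    refine (at_le_at.2 (Nat.le_add_right _ j)).trans (le_sSup ⟨lt_of_lt_of_le ?_ hP, _, rfl, ?_⟩)
    · rw [at_lt_at, List.length_append]; omega
    · rw [List.append_assoc, List.append_assoc, List.getElem?_append_right (by omega),
        Nat.add_sub_cancel_left, List.getElem?_append_left hj, List.getElem?_eq_getElem hj, hja]

/-- An instruction `toEnd`, or one for a letter missing in `u`, leads to `⊤`, and no later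
instruction leaves it. -/
theorem xEval_eq_top {u : List A} (hu : alph u ⊆ alph w) {ρ : XRanker A}
    (hρ : ¬ ∀ X ∈ ρ, ∃ a ∈ w, X = XInstr.next a) : xEval ρ u = ⊤ := by
  induction ρ using List.reverseRecOn with
  | nil => simp at hρ
  | append_singleton ρ X ih =>
    rw [xEval_snoc]
    by_cases h : ∀ X ∈ ρ, ∃ a ∈ w, X = XInstr.next a
    · cases X with
      | toEnd => rfl
      | next a =>
        refine next_top fun i _ hi => hρ ?_
        have ha : a ∈ w := hu (List.mem_iff_getElem?.2 ⟨i, hi⟩)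
        intro X hX
        rcases List.mem_append.1 hX with hX | hX
        · exact h X hX
        · exact ⟨a, ha, List.mem_singleton.1 hX⟩
    · rw [ih h]
      cases X with
      | toEnd => rfl
      | next a => exact next_top (by simp)

theorem yEval_eq_bot {u : List A} (hu : alph u ⊆ alph w) {l : YRanker A}
    (hl : ¬ ∀ Y ∈ l, ∃ a ∈ w, Y = YInstr.prev a) : yEval l u = ⊥ := by
  induction l using List.reverseRecOn with
  | nil => simp at hl
  | append_singleton l Y ih =>
    rw [yEval_snoc]
    by_cases h : ∀ Y ∈ l, ∃ a ∈ w, Y = YInstr.prev a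
    · cases Y with
      | toStart => rfl
      | prev a =>
        refine prev_bot fun i _ hi => hl ?_
        have ha : a ∈ w := hu (List.mem_iff_getElem?.2 ⟨i, hi⟩)
        intro X hX
        rcases List.mem_append.1 hX with hX | hX
        · exact h X hX
        · exact ⟨a, ha, List.mem_singleton.1 hX⟩
    · rw [ih h]
      cases Y with
      | toStart => rfl
      | prev a => exact prev_bot (by simp)

theorem alph_between_subset (u : List A) (p q : Pos) : alph (between u p q) ⊆ alph u := by
  intro a ha
  rw [between_eq_block] at ha
  exact List.mem_of_mem_take (List.mem_of_mem_drop ha)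

/-- `u` has the letters of `w`, and all `X`-rankers and `Y`-rankers over these letters of length at
most `n` are separated in `u` by an occurrence of each of these letters. -/
structure Rich (w : List A) (n : ℕ) (u : List A) : Prop where
  subset : alph u ⊆ alph w
  sep : ∀ (ρ : XRanker A) (l : YRanker A), ρ.length ≤ n → l.length ≤ n →
    (∀ X ∈ ρ, ∃ a ∈ w, X = XInstr.next a) → (∀ Y ∈ l, ∃ a ∈ w, Y = YInstr.prev a) →
    xEval ρ u < yEval l u ∧ alph (between u (xEval ρ u) (yEval l u)) = alph w

/-- The first `n` copies of `w` contain the reach of the `X`-rankers and the last `n` copies that of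
the `Y`-rankers. The copy in the middle lies strictly between and provides every letter. -/
theorem rich_of_power (n : ℕ) {h h' : List A} (hh : alph h ⊆ alph w)
    (hh' : alph h' ⊆ alph w) :
    Rich w n (h ++ (List.replicate (n + (1 + n)) w).flatten ++ h') := by
  have hr : ∀ k, alph (List.replicate k w).flatten ⊆ alph w := by
    intro k a ha
    obtain ⟨x, hx, ha⟩ := List.mem_flatten.1 ha
    rwa [List.eq_of_mem_replicate hx] at ha
  have hsub : alph (h ++ (List.replicate (n + (1 + n)) w).flatten ++ h') ⊆ alph w := by
    rw [alph_append, alph_append]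
    exact Set.union_subset (Set.union_subset hh (hr _)) hh'
  refine ⟨hsub, fun ρ l hρ hl hρ' hl' => ?_⟩
  have hx := xEval_lt_of_length_le h (w ++ (List.replicate n w).flatten ++ h') hρ' hρ
  have hy := le_yEval_of_length_le h' (h ++ (List.replicate n w).flatten ++ w) hl' hl
  have e1 : h ++ (List.replicate n w).flatten ++ (w ++ (List.replicate n w).flatten ++ h') =
      h ++ (List.replicate (n + (1 + n)) w).flatten ++ h' := by
    rw [List.replicate_add, List.replicate_add]; simp
  have e2 : h ++ (List.replicate n w).flatten ++ w ++ (List.replicate n w).flatten ++ h' =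
      h ++ (List.replicate (n + (1 + n)) w).flatten ++ h' := by
    rw [List.replicate_add, List.replicate_add]; simp
  have hlen : (h ++ (List.replicate n w).flatten ++ w).length =
      h.length + n * w.length + w.length := by
    simp [add_assoc]
  rw [e1] at hx
  rw [e2, hlen] at hy
  refine ⟨hx.trans_le ((at_le_at.2 (by omega)).trans hy), ?_⟩
  refine ((alph_between_subset _ _ _).trans hsub).antisymm fun a ha => ?_
  obtain ⟨j, hj, hja⟩ := List.mem_iff_getElem.1 ha
  rw [between_eq_block]
  have hget : (h ++ (List.replicate (n + (1 + n)) w).flatten ++ h')[h.length + n * w.length + j]? =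
      some a := by
    have hlen' : (h ++ (List.replicate n w).flatten).length = h.length + n * w.length := by simp
    rw [← e1, List.getElem?_append_right (by omega), hlen', Nat.add_sub_cancel_left,
      List.append_assoc, List.getElem?_append_left hj, List.getElem?_eq_getElem hj, hja]
  refine mem_block (i := h.length + n * w.length + j + 1) ?_ ?_ (by simpa using hget)
  · refine Nat.lt_succ_of_le ?_
    rw [← lt_at_iff (w := h ++ (List.replicate (n + (1 + n)) w).flatten ++ h') hx.ne_top]
    exact hx.trans_le (at_le_at.2 (by omega))
  · rw [← at_lt_iff (List.getElem?_eq_some_iff.1 hget).1]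
    exact lt_of_lt_of_le (at_lt_at.2 (by omega)) hy

/-- The bound is `n + 1` because the prefixes may include the closing instruction. If both rankers
only use letters of `w`, the middle part has all these letters, and the letters subject to counting
occur nowhere. Otherwise some ranker evaluates to an imaginary position, and the only splits to
compare are those with an empty middle that put the whole word on one side. -/
theorem Rich.approx {m n : ℕ} {u v : List A} (hu : Rich w (n + 1) u) (hv : Rich w (n + 1) v)
    (hc : ∀ a, cnt a u = cnt a v) : Approx m n u v := by
  rw [approx_iff]
  rintro ρ' l' ⟨ρ, l, hn, h1, h2⟩
  have hlx : ρ'.length ≤ n + 1 := by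
    have := h1.length_le
    rw [List.length_append, List.length_singleton] at this
    omega
  have hly : l'.length ≤ n + 1 := by
    have := h2.length_le
    rw [List.length_append, List.length_singleton] at this
    omega
  by_cases hx : ∀ X ∈ ρ', ∃ a ∈ w, X = XInstr.next a <;>
  by_cases hy : ∀ Y ∈ l', ∃ a ∈ w, Y = YInstr.prev a
  · obtain ⟨a1, a2⟩ := hu.sep ρ' l' hlx hly hx hy
    obtain ⟨b1, b2⟩ := hv.sep ρ' l' hlx hly hx hy
    refine ⟨?_, fun _ => ⟨?_, fun a ha => ?_⟩⟩
    · rw [ord, ord, (cmp_eq_lt_iff _ _).2 a1, (cmp_eq_lt_iff _ _).2 b1]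
    · rw [middlePart, middlePart, a2, b2]
    · rw [middlePart, a2] at ha
      have hz : ∀ z : List A, alph z ⊆ alph w → cnt a z = 0 := fun z hz =>
        cnt_eq_zero fun hc => ha (hz hc)
      simp only [leftPart, rightPart]
      rw [hz _ ((alph_between_subset _ _ _).trans hu.subset),
        hz _ ((alph_between_subset _ _ _).trans hv.subset),
        hz _ ((alph_between_subset _ _ _).trans hu.subset),
        hz _ ((alph_between_subset _ _ _).trans hv.subset)]
      exact ⟨rfl, rfl⟩
  · have e1 := yEval_eq_bot hu.subset hy
    have e2 := yEval_eq_bot hv.subset hy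
    rcases eq_or_ne ρ' [] with rfl | hne
    · refine ⟨by simp [ord, e1, e2], fun _ => ?_⟩
      simp [SplitCond, middlePart, leftPart, rightPart, e1, e2, between_self, between_bot_top, hc,
        Nat.ModEq.refl]
    · have p1 := xEval_ne_bot hne u
      have p2 := xEval_ne_bot hne v
      refine ⟨?_, fun hle => absurd (le_bot_iff.1 (by rwa [e1] at hle)) p1⟩
      rw [ord, ord, e1, e2, (cmp_eq_gt_iff _ _).2 p1.bot_lt, (cmp_eq_gt_iff _ _).2 p2.bot_lt]
  · have e1 := xEval_eq_top hu.subset hx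
    have e2 := xEval_eq_top hv.subset hx
    rcases eq_or_ne l' [] with rfl | hne
    · refine ⟨by simp [ord, e1, e2], fun _ => ?_⟩
      simp [SplitCond, middlePart, leftPart, rightPart, e1, e2, between_self, between_bot_top, hc,
        Nat.ModEq.refl]
    · have p1 := yEval_ne_top hne u
      have p2 := yEval_ne_top hne v
      refine ⟨?_, fun hle => absurd (top_le_iff.1 (by rwa [e1] at hle)) p1⟩
      rw [ord, ord, e1, e2, (cmp_eq_gt_iff _ _).2 p1.lt_top, (cmp_eq_gt_iff _ _).2 p2.lt_top]
  · rw [ord, ord, xEval_eq_top hu.subset hx, xEval_eq_top hv.subset hx, yEval_eq_bot hu.subset hy,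
      yEval_eq_bot hv.subset hy]
    exact ⟨rfl, fun hle => absurd hle (by simp)⟩

end Rich

/-! ### Quotients of the free semigroup by `≈` -/

section Backward

variable {A S : Type*} [Semigroup S] {m n : ℕ}

/-- The power `w ^ (k + 1)` in the free semigroup. -/
def succPow (w : FreeSemigroup A) : ℕ → FreeSemigroup A
  | 0 => w
  | k + 1 => w * succPow w k

theorem word_succPow (w : FreeSemigroup A) (k : ℕ) :
    word (succPow w k) = (List.replicate (k + 1) (word w)).flatten := by
  induction k with
  | zero => simp [succPow]
  | succ k ih => rw [succPow, word_mul, ih, List.replicate_succ (n := k + 1), List.flatten_cons]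

theorem map_succPow (f : (approxCon A m n).Quotient →ₙ* S) (w : FreeSemigroup A) {e : S}
    (he : IsIdempotentElem e) (hw : f (w : (approxCon A m n).Quotient) = e) (k : ℕ) :
    f (succPow w k : (approxCon A m n).Quotient) = e := by
  induction k with
  | zero => exact hw
  | succ k ih => rw [succPow, Con.coe_mul, map_mul, hw, ih, he]

/-- A power of `w` still maps to the idempotent `e`. Placed beside a sufficiently high power, `z`
and `z'` can be exchanged or moved to the other side within one class of ≈, by `Rich.approx`. -/
theorem map_mul_comm (f : (approxCon A m n).Quotient →ₙ* S) (w z z' : FreeSemigroup A) {e : S}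
    (he : IsIdempotentElem e) (hw : f (w : (approxCon A m n).Quotient) = e)
    (hz : alph (word z) ⊆ alph (word w)) (hz' : alph (word z') ⊆ alph (word w))
    (hc : ∀ a, cnt a (word z) = cnt a (word z')) :
    e * f (z : (approxCon A m n).Quotient) = f (z' : (approxCon A m n).Quotient) * e ∧
    e * f (z : (approxCon A m n).Quotient) = e * f (z' : (approxCon A m n).Quotient) := by
  -- There are `n + 1` copies for each side and one in the middle; `succPow w k` has `k + 1` copies.
  obtain ⟨k, hk⟩ : ∃ k, n + 1 + (1 + (n + 1)) = k + 1 := ⟨n + 1 + (n + 1), by omega⟩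
  have r : ∀ {h h' : List A}, alph h ⊆ alph (word w) → alph h' ⊆ alph (word w) →
      Rich (word w) (n + 1) (h ++ word (succPow w k) ++ h') := by
    intro h h' hh hh'
    rw [word_succPow, ← hk]
    exact rich_of_power _ hh hh'
  have hnil : alph ([] : List A) ⊆ alph (word w) := by simp [alph]
  have r1 : Rich (word w) (n + 1) (word (succPow w k * z)) := by
    simpa [word_mul] using r hnil hz
  have r2 : Rich (word w) (n + 1) (word (z' * succPow w k)) := by
    simpa [word_mul] using r hz' hnil
  have r3 : Rich (word w) (n + 1) (word (succPow w k * z')) := by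
    simpa [word_mul] using r hnil hz'
  have a1 : ((succPow w k * z : FreeSemigroup A) : (approxCon A m n).Quotient) =
      (z' * succPow w k : FreeSemigroup A) :=
    (Con.eq _).2 (r1.approx r2 fun a => by
      rw [word_mul, word_mul, cnt_append, cnt_append, hc, add_comm])
  have a2 : ((succPow w k * z : FreeSemigroup A) : (approxCon A m n).Quotient) =
      (succPow w k * z' : FreeSemigroup A) :=
    (Con.eq _).2 (r1.approx r3 fun a => by
      rw [word_mul, word_mul, cnt_append, cnt_append, hc])
  have hp := map_succPow f w he hw k
  have b1 := congrArg f a1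
  have b2 := congrArg f a2
  rw [Con.coe_mul, Con.coe_mul, map_mul, map_mul, hp] at b1 b2
  exact ⟨b1, b2⟩

/-- The factors of an idempotent commute with it, and they commute with each other below it. -/
def FactorsCommute (S : Type*) [Semigroup S] : Prop :=
  ∀ e s t r : S, IsIdempotentElem e → e = s * t * r →
    e * s = s * e ∧ e * t = t * e ∧ e * (s * t) = e * (t * s)

/-- A word for `e` is composed of words for its three factors, so it contains all their letters. The
commutation below `e` comes from `map_mul_comm` for the two orders of the product, which have equal
counts. -/
theorem factorsCommute_of_surjective (f : (approxCon A m n).Quotient →ₙ* S)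
    (hf : Function.Surjective f) : FactorsCommute S := by
  have lift : ∀ s, ∃ w : FreeSemigroup A, f (w : (approxCon A m n).Quotient) = s := by
    intro s
    obtain ⟨q, rfl⟩ := hf s
    induction q using Con.induction_on with
    | _ w => exact ⟨w, rfl⟩
  intro e s t r he h
  obtain ⟨ws, rfl⟩ := lift s
  obtain ⟨wt, rfl⟩ := lift t
  obtain ⟨wr, rfl⟩ := lift r
  have hw : f ((ws * wt * wr : FreeSemigroup A) : (approxCon A m n).Quotient) = e := by
    rw [h, Con.coe_mul, Con.coe_mul, map_mul, map_mul]
  have key := map_mul_comm f (ws * wt * wr)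
  simp only [word_mul, alph_append] at key
  refine ⟨(key ws ws he hw ?_ ?_ fun _ => rfl).1, (key wt wt he hw ?_ ?_ fun _ => rfl).1, ?_⟩
  any_goals intro a ha; simp [ha]
  have := (map_mul_comm f (ws * wt * wr) (ws * wt) (wt * ws) he hw ?_ ?_ ?_).2
  · simpa only [Con.coe_mul, map_mul] using this
  · simp only [word_mul, alph_append]; intro a ha; exact Or.inl ha
  · simp only [word_mul, alph_append]; intro a ha; exact Or.inl ha.symm
  · intro a; rw [word_mul, word_mul, cnt_append, cnt_append, add_comm]

/-! ### The 𝒟-class of an idempotent as a group of units. -/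

theorem GreenL.symm {s t : S} : GreenL s t → GreenL t s :=
  fun ⟨x, y, h, h'⟩ => ⟨y, x, h'.symm, h.symm⟩

theorem GreenR.symm {s t : S} : GreenR s t → GreenR t s :=
  fun ⟨x, y, h, h'⟩ => ⟨y, x, h'.symm, h.symm⟩

theorem GreenL.trans {s t r : S} : GreenL s t → GreenL t r → GreenL s r :=
  fun ⟨x, y, h, h'⟩ ⟨z, w, k, k'⟩ =>
    ⟨z * x, y * w, by rw [mul_assoc, h, k], by rw [h', k', mul_assoc]⟩

theorem GreenR.trans {s t r : S} : GreenR s t → GreenR t r → GreenR s r :=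
  fun ⟨x, y, h, h'⟩ ⟨z, w, k, k'⟩ =>
    ⟨x * z, w * y, by rw [← mul_assoc, h, k], by rw [h', k', mul_assoc]⟩

theorem GreenD.symm {s t : S} (h : GreenD s t) : GreenD t s := by
  induction h with
  | refl => exact Relation.ReflTransGen.refl
  | tail _ h ih => exact Relation.ReflTransGen.head (h.imp GreenL.symm GreenR.symm) ih

/-- `t` lies in the group of units of `e * S * e`. -/
def IsUnitBelow (e t : S) : Prop :=
  e * t = t ∧ t * e = t ∧ ∃ r, e * r = r ∧ r * e = r ∧ t * r = e ∧ r * t = e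

/-- ℛ-equivalence gives a right inverse `r` of `t`. Applying the hypothesis to `e = t * r * e` makes
`e` a two-sided identity for both and `r` a two-sided inverse. -/
theorem FactorsCommute.isUnitBelow_of_greenR (hS : FactorsCommute S) {e t : S}
    (he : IsIdempotentElem e) (h : GreenR e t) : IsUnitBelow e t := by
  obtain ⟨y, y', h1, h2⟩ := h
  obtain ⟨r, hr⟩ := exists_coe_eq_mul y' 1 e
  rw [mul_one] at hr
  have het : e * t = t := by
    rw [← WithOne.coe_inj, WithOne.coe_mul, ← h1, ← mul_assoc, ← WithOne.coe_mul, he]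
  have htr : t * r = e := by
    rw [← WithOne.coe_inj, WithOne.coe_mul, hr, ← mul_assoc, ← h2, ← WithOne.coe_mul, he]
  have hre : r * e = r := by
    rw [← WithOne.coe_inj, WithOne.coe_mul, hr, mul_assoc, ← WithOne.coe_mul, he]
  obtain ⟨c1, c2, c3⟩ := hS e t r e he (by rw [htr, he])
  have hte : t * e = t := by rw [← c1, het]
  have her : e * r = r := by rw [c2, hre]
  exact ⟨het, hte, r, her, hre, htr, by rw [htr, he, ← mul_assoc, her] at c3; exact c3.symm⟩

theorem FactorsCommute.isUnitBelow_of_greenL (hS : FactorsCommute S) {e t : S}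
    (he : IsIdempotentElem e) (h : GreenL e t) : IsUnitBelow e t := by
  obtain ⟨y, y', h1, h2⟩ := h
  obtain ⟨r, hr⟩ := exists_coe_eq_mul 1 y' e
  rw [one_mul] at hr
  have hte : t * e = t := by
    rw [← WithOne.coe_inj, WithOne.coe_mul, ← h1, mul_assoc, ← WithOne.coe_mul, he]
  have hrt : r * t = e := by
    rw [← WithOne.coe_inj, WithOne.coe_mul, hr, mul_assoc, ← h2, ← WithOne.coe_mul, he]
  have her : e * r = r := by
    rw [← WithOne.coe_inj, WithOne.coe_mul, hr, ← mul_assoc, ← WithOne.coe_mul, he]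
  obtain ⟨c1, c2, c3⟩ := hS e r t e he (by rw [hrt, he])
  have het : e * t = t := by rw [c2, hte]
  have hre : r * e = r := by rw [← c1, her]
  exact ⟨het, hte, r, her, hre, by rw [hrt, he, ← mul_assoc, het] at c3; exact c3.symm, hrt⟩

theorem IsUnitBelow.greenR {e t : S} (h : IsUnitBelow e t) : GreenR e t := by
  obtain ⟨h1, _, r, _, _, h2, _⟩ := h
  exact ⟨t, r, by rw [← WithOne.coe_mul, h1], by rw [← WithOne.coe_mul, h2]⟩

theorem IsUnitBelow.greenL {e t : S} (h : IsUnitBelow e t) : GreenL e t := by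
  obtain ⟨_, h1, r, _, _, _, h2⟩ := h
  exact ⟨t, r, by rw [← WithOne.coe_mul, h1], by rw [← WithOne.coe_mul, h2]⟩

/-- A unit of eSe is both ℒ- and ℛ-related to `e`, so every further link of a chain starting at `e`
can be attached to `e` directly. -/
theorem FactorsCommute.greenD_iff (hS : FactorsCommute S) {e t : S}
    (he : IsIdempotentElem e) : GreenD e t ↔ IsUnitBelow e t := by
  refine ⟨fun h => ?_, fun h => Relation.ReflTransGen.single (Or.inr h.greenR)⟩
  induction h with
  | refl => exact ⟨he, he, e, he, he, he, he⟩
  | tail _ h ih =>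
    rcases h with h | h
    · exact hS.isUnitBelow_of_greenL he (ih.greenL.trans h)
    · exact hS.isUnitBelow_of_greenR he (ih.greenR.trans h)

/-- Units `s`, `t` with inverses `s'`, `t'` satisfy `e = s t (t' s')`, so both are factors of `e`
and commute below it; being fixed by `e`, they commute outright. -/
theorem FactorsCommute.isDAbS [Finite S] (hS : FactorsCommute S) : IsDAbS S := by
  refine ⟨inferInstance, ?_⟩
  rintro s ⟨e, hse, he⟩
  have hD : {t : S | GreenD s t} = {t | IsUnitBelow e t} := by
    ext t
    rw [Set.mem_ofPred_eq, Set.mem_ofPred_eq, ← hS.greenD_iff he]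
    exact ⟨fun h => Relation.ReflTransGen.trans hse.symm h,
      fun h => Relation.ReflTransGen.trans hse h⟩
  rw [hD]
  refine ⟨?_, ?_, e, ⟨he, he, e, he, he, he, he⟩, fun s hs => hs.1, ?_⟩
  · rintro s ⟨s1, s2, s', s3, s4, s5, s6⟩ t ⟨t1, t2, t', t3, t4, t5, t6⟩
    refine ⟨by rw [← mul_assoc, s1], by rw [mul_assoc, t2], t' * s', by rw [← mul_assoc, t3],
      by rw [mul_assoc, s4], ?_, ?_⟩
    · rw [mul_assoc, ← mul_assoc t, t5, s3, s5]
    · rw [mul_assoc, ← mul_assoc s', s6, t1, t6]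
  · rintro s ⟨s1, s2, s', s3, s4, s5, s6⟩ t ⟨t1, t2, t', t3, t4, t5, t6⟩
    have := (hS e s t (t' * s') he (by rw [mul_assoc, ← mul_assoc t, t5, s3, s5])).2.2
    rwa [← mul_assoc, ← mul_assoc, s1, t1] at this
  · rintro s ⟨s1, s2, s', s3, s4, s5, s6⟩
    exact ⟨s', ⟨s3, s4, s, s1, s2, s6, s5⟩, s6⟩

/-! ### Finiteness of the quotient. -/

/-- A class of ≈ is determined by orders, alphabets and residues for the finitely many rankers of
length at most `n + 1`. Recording the residues of all letters, not only of those outside the middle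
part, refines ≈ and keeps the data finite. -/
theorem finite_quotient [Finite A] (hm : 1 ≤ m) : Finite (approxCon A m n).Quotient := by
  have : NeZero m := ⟨by omega⟩
  have fx : Finite (XInstr A) := by
    refine Finite.of_injective (β := Option A)
      (fun X => match X with | .next a => some a | .toEnd => none) ?_
    rintro (a | _) (b | _) h <;> simp_all
  have fy : Finite (YInstr A) := by
    refine Finite.of_injective (β := Option A)
      (fun Y => match Y with | .prev a => some a | .toStart => none) ?_
    rintro (a | _) (b | _) h <;> simp_all
  have fX : Finite {ρ : XRanker A // ρ.length ≤ n + 1} :=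
    (List.finite_length_le (XInstr A) (n + 1)).to_subtype
  have fY : Finite {l : YRanker A // l.length ≤ n + 1} :=
    (List.finite_length_le (YInstr A) (n + 1)).to_subtype
  let data (u : FreeSemigroup A) (x : {ρ : XRanker A // ρ.length ≤ n + 1} ×
      {l : YRanker A // l.length ≤ n + 1}) :
      Ordering × Set A × (A → ZMod m) × (A → ZMod m) :=
    (ord x.1.1 x.2.1 (word u), alph (middlePart x.1.1 x.2.1 (word u)),
      modCount m (leftPart x.1.1 (word u)), modCount m (rightPart x.2.1 (word u)))
  have hdata : ∀ u v, data u = data v → Approx m n (word u) (word v) := by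
    intro u v h
    rw [approx_iff]
    rintro ρ' l' ⟨ρ, l, hn, h1, h2⟩
    have hlx := h1.length_le
    have hly := h2.length_le
    rw [List.length_append, List.length_singleton] at hlx hly
    have := congrFun h (⟨ρ', by omega⟩, ⟨l', by omega⟩)
    simp only [data, Prod.mk.injEq] at this
    obtain ⟨e1, e2, e3, e4⟩ := this
    exact ⟨e1, fun _ => ⟨e2, fun a _ => ⟨(ZMod.natCast_eq_natCast_iff _ _ _).1 (congrFun e3 a),
      (ZMod.natCast_eq_natCast_iff _ _ _).1 (congrFun e4 a)⟩⟩⟩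
  refine Finite.of_injective (fun q : (approxCon A m n).Quotient => data (Quotient.out q)) ?_
  intro p q h
  rw [← Quotient.out_eq p, ← Quotient.out_eq q]
  exact Quotient.sound (hdata _ _ h)

end Backward

end DAb

theorem mainTheorem6 {A : Type*} {S : Type*} [Semigroup S] (ι : A → S)
    (hgen : Subsemigroup.closure (Set.range ι) = ⊤) (hfin : Finite A ∨ Finite S) :
    DAb.IsDAbS S ↔
      ∃ m n : ℕ, 1 ≤ m ∧ 1 ≤ n ∧
        ∃ f : (DAb.approxCon A m n).Quotient →ₙ* S, Function.Surjective f := by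
  refine ⟨fun hS => hS.exists_hom ι hgen, ?_⟩
  rintro ⟨m, n, hm, -, f, hf⟩
  have : Finite S := by
    rcases hfin with hA | hS
    · have := DAb.finite_quotient (A := A) (n := n) hm
      exact Finite.of_surjective f hf
    · exact hS
  exact (DAb.factorsCommute_of_surjective f hf).isDAbS
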